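/- Let $(N,h)$ be a Riemannian manifold (smooth, without boundary, not necessarily complete) with non-positive sectional curvature. Let $(M^m,g)$ be a compact Riemannian manifold without boundary, and let $\phi:(M,g)\to(N,h)$ be a smooth isometric immersion. Let $\mathbf H=\frac1m\sum_{i=1}^m B(e_i,e_i)$ be its mean curvature vector field, where $B(X,Y)=\nabla^N_XY-\nabla_XY$ is the second fundamental form and $\{e_i\}_{i=1}^m$ is a local orthonormal frame of $M$. Suppose that $M$ is a non-negative biminimal submanifold of $N$, that is, for some real constant $\lambda\ge 0$, $$\Big[-\Delta^\phi\mathbf H-\sum_{i=1}^m R^N(\mathbf H,d\phi(e_i))\,d\phi(e_i)\Big]^\perp+\lambda\,\mathbf H=0\quad\text{on } M .$$ Here $\Delta^\phi=\sum_{i=1}^m\big(\nabla^\phi_{e_i}\nabla^\phi_{e_i}-\nabla^\phi_{\nabla_{e_i}e_i}\big)$, $\nabla^\phi$ is the connection induced on $\phi^*TN$ by the Levi-Civita connection $\nabla^N$ of $N$, $R^N(X,Y)Z=[\nabla^N_X,\nabla^N_Y]Z-\nabla^N_{[X,Y]}Z$, and $[\,\cdot\,]^\perp$ is the component normal to $d\phi(TM)$.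 Then $M$ is minimal, that is, $\mathbf H=0$ on $M$. -/

import Mathlib

open Bundle
open scoped Manifold ContDiff

noncomputable section

namespace Biminimal

section Riemannian

/-! Riemannian manifolds are smooth manifolds without boundary, modelled on `ℝ^n`, with a smooth
Riemannian metric on the tangent bundle. -/

variable {n : ℕ} {N : Type*} [TopologicalSpace N] [ChartedSpace (EuclideanSpace ℝ (Fin n)) N]
  [IsManifold (𝓡 n) ∞ N]

instance (q : N) : FiniteDimensional ℝ (TangentSpace (𝓡 n) q) :=
  inferInstanceAs (FiniteDimensional ℝ (EuclideanSpace ℝ (Fin n)))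

/-- The vector field which extends `u ∈ T_q N` and has constant components `u^i ∂_i` in the
coordinates given by the preferred chart at `q`, on the domain of that chart. -/
def coordField {q : N} (u : TangentSpace (𝓡 n) q) (p : N) : TangentSpace (𝓡 n) p :=
  FiberBundle.extend (EuclideanSpace ℝ (Fin n)) u p

variable [RiemannianBundle (fun q : N ↦ TangentSpace (𝓡 n) q)]

/-- `D_u ⟨W, Z⟩` at `q`, where `W`, `Z` are the coordinate-constant extensions of `w`, `z`. -/
def metricDeriv {q : N} (u w z : TangentSpace (𝓡 n) q) : ℝ :=
  mvfderiv (𝓡 n) (fun p : N ↦ (inner ℝ (coordField w p) (coordField z p) : ℝ)) q u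

/-- The Christoffel symbols of the Levi-Civita connection in the preferred chart at `q`, at the
point `q`. This is `Γ(u, w) = ∇_u W` for the coordinate-constant extension `W` of `w`. It is given by
the Koszul formula (coordinate fields commute)
`2 ⟨Γ(u, w), z⟩ = D_u ⟨W, Z⟩ + D_w ⟨U, Z⟩ - D_z ⟨U, W⟩`. -/
def christoffel {q : N} (u w : TangentSpace (𝓡 n) q) : TangentSpace (𝓡 n) q :=
  let e := stdOrthonormalBasis ℝ (TangentSpace (𝓡 n) q)
  ∑ k, ((metricDeriv u w (e k) + metricDeriv w u (e k) - metricDeriv (e k) u w) / 2) • e k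

variable {m : ℕ} {M : Type*} [TopologicalSpace M] [ChartedSpace (EuclideanSpace ℝ (Fin m)) M]
  [IsManifold (𝓡 m) ∞ M]

/-- The connection `∇^φ` induced on `φ^* TN` by the Levi-Civita connection of `N`:
`∇^φ_v W = dW^k(v) ∂_k + Γ(dφ(v), W)` for a section `W` of `φ^* TN` and `v ∈ T_x M`, in the
preferred chart of `N` at `φ x`. -/
def covDerivAlong (φ : M → N) (W : ∀ y : M, TangentSpace (𝓡 n) (φ y)) {x : M}
    (v : TangentSpace (𝓡 m) x) : TangentSpace (𝓡 n) (φ x) :=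
  let t := trivializationAt (EuclideanSpace ℝ (Fin n)) (TangentSpace (𝓡 n) : N → Type _) (φ x)
  t.symmL ℝ (φ x) (mvfderiv (𝓡 m) (fun y : M ↦ t.continuousLinearMapAt ℝ (φ y) (W y)) x v)
    + christoffel (mfderiv (𝓡 m) (𝓡 n) φ x v) (W x)

/-- The Levi-Civita connection: `leviCivita Y u = ∇_u Y`. -/
def leviCivita (Y : ∀ p : N, TangentSpace (𝓡 n) p) {q : N} (u : TangentSpace (𝓡 n) q) :
    TangentSpace (𝓡 n) q :=
  covDerivAlong (m := n) (M := N) (fun p ↦ p) Y u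

/-- The Riemann curvature `R(u, v)w`, that is `∇_U ∇_V W - ∇_V ∇_U W - ∇_[U, V] W` for the
coordinate-constant extensions of `u`, `v`, `w`, for which `[U, V] = 0` near `q`. -/
def curvature {q : N} (u v w : TangentSpace (𝓡 n) q) : TangentSpace (𝓡 n) q :=
  leviCivita (fun p ↦ leviCivita (coordField w) (coordField v p)) u
    - leviCivita (fun p ↦ leviCivita (coordField w) (coordField u p)) v

/-- The sectional curvature of the plane spanned by linearly independent `u`, `v`. -/
def sectionalCurvature {q : N} (u v : TangentSpace (𝓡 n) q) : ℝ :=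
  inner ℝ (curvature u v v) u / (‖u‖ ^ 2 * ‖v‖ ^ 2 - (inner ℝ u v) ^ 2)

variable (n N) in
/-- All sectional curvatures of `N` are non-positive. -/
def NonposSectionalCurvature : Prop :=
  ∀ (q : N) (u v : TangentSpace (𝓡 n) q), LinearIndependent ℝ ![u, v] →
    sectionalCurvature u v ≤ 0

end Riemannian

section Immersion

variable {m n : ℕ}
  {M : Type*} [TopologicalSpace M] [ChartedSpace (EuclideanSpace ℝ (Fin m)) M]
  [IsManifold (𝓡 m) ∞ M] [RiemannianBundle (fun x : M ↦ TangentSpace (𝓡 m) x)]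
  {N : Type*} [TopologicalSpace N] [ChartedSpace (EuclideanSpace ℝ (Fin n)) N]
  [IsManifold (𝓡 n) ∞ N] [RiemannianBundle (fun q : N ↦ TangentSpace (𝓡 n) q)]

variable (m n) in
/-- Smooth isometric immersions; `dφ_x` is injective because it preserves the metric. -/
structure IsIsometricImmersion (φ : M → N) : Prop where
  contMDiff : ContMDiff (𝓡 m) (𝓡 n) ∞ φ
  inner_mfderiv : ∀ (x : M) (u v : TangentSpace (𝓡 m) x),
    (inner ℝ (mfderiv (𝓡 m) (𝓡 n) φ x u) (mfderiv (𝓡 m) (𝓡 n) φ x v) : ℝ) = inner ℝ u v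

/-- The second fundamental form, by the Gauss formula: `B(u, v) = ∇^N_u V - ∇_u V`, where the
tangent field `V` is identified with the section `dφ(V)` of `φ^* TN`. -/
def secondFundamentalForm (φ : M → N) {x : M} (u v : TangentSpace (𝓡 m) x) :
    TangentSpace (𝓡 n) (φ x) :=
  covDerivAlong φ (fun y ↦ mfderiv (𝓡 m) (𝓡 n) φ y (coordField v y)) u
    - mfderiv (𝓡 m) (𝓡 n) φ x (leviCivita (coordField v) u)

variable (m n) in
/-- The mean curvature vector field `H = (1/m) ∑ B(e_i, e_i)`, for an orthonormal basis `e_i` of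
`T_x M`. -/
def meanCurvature (φ : M → N) (x : M) : TangentSpace (𝓡 n) (φ x) :=
  let e := stdOrthonormalBasis ℝ (TangentSpace (𝓡 m) x)
  (1 / (m : ℝ)) • ∑ i, secondFundamentalForm φ (e i) (e i)

variable (m n) in
/-- `M` is minimal when its mean curvature vector field vanishes. -/
def IsMinimal (φ : M → N) : Prop :=
  ∀ x : M, meanCurvature m n φ x = 0

/-- The second covariant derivative `∇^φ_U ∇^φ_V W - ∇^φ_(∇_U V) W` of a section `W` of `φ^* TN`.
It is tensorial in `u`, `v`; the coordinate-constant extension `V` of `v` is used. -/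
def secondCovDerivAlong (φ : M → N) (W : ∀ y : M, TangentSpace (𝓡 n) (φ y)) {x : M}
    (u v : TangentSpace (𝓡 m) x) : TangentSpace (𝓡 n) (φ x) :=
  covDerivAlong φ (fun y ↦ covDerivAlong φ W (coordField v y)) u
    - covDerivAlong φ W (leviCivita (coordField v) u)

variable (m n) in
/-- The rough Laplacian `Δ^φ W = ∑ (∇^φ_{e_i} ∇^φ_{e_i} - ∇^φ_{∇_{e_i} e_i}) W`. -/
def laplacianAlong (φ : M → N) (W : ∀ y : M, TangentSpace (𝓡 n) (φ y)) (x : M) :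
    TangentSpace (𝓡 n) (φ x) :=
  let e := stdOrthonormalBasis ℝ (TangentSpace (𝓡 m) x)
  ∑ i, secondCovDerivAlong φ W (e i) (e i)

variable (m n) in
/-- The orthogonal projection `w ↦ w^⊥` of `T_{φ(x)} N` onto the normal space
`dφ(T_x M)^⊥`. -/
def normalPart (φ : M → N) (x : M) (w : TangentSpace (𝓡 n) (φ x)) : TangentSpace (𝓡 n) (φ x) :=
  (LinearMap.range (mfderiv (𝓡 m) (𝓡 n) φ x).toLinearMap)ᗮ.starProjection w

variable (m n) in
/-- An isometric immersion `φ` makes `M` a biminimal submanifold of `N` with constant `l` when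
`[-Δ^φ H - ∑ R^N(H, dφ(e_i)) dφ(e_i)]^⊥ + l H = 0`. -/
structure IsBiminimalSubmanifold (φ : M → N) (l : ℝ) : Prop where
  isIsometricImmersion : IsIsometricImmersion m n φ
  biminimal_eq : ∀ x : M,
    let e := stdOrthonormalBasis ℝ (TangentSpace (𝓡 m) x)
    normalPart m n φ x (-laplacianAlong m n φ (meanCurvature m n φ) x
      - ∑ i, curvature (meanCurvature m n φ x) (mfderiv (𝓡 m) (𝓡 n) φ x (e i))
          (mfderiv (𝓡 m) (𝓡 n) φ x (e i)))
      + l • meanCurvature m n φ x = 0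

variable (m n) in
/-- Non-negative biminimal submanifolds: biminimal with some constant `l ≥ 0`. -/
def IsNonnegBiminimalSubmanifold (φ : M → N) : Prop :=
  ∃ l : ℝ, 0 ≤ l ∧ IsBiminimalSubmanifold m n φ l

end Immersion

end Biminimal

end

set_option linter.unusedSectionVars false

noncomputable section

namespace Biminimal

open Filter
open scoped Topology

section Sections

variable {n : ℕ} {N : Type*} [TopologicalSpace N] [ChartedSpace (EuclideanSpace ℝ (Fin n)) N]
  [IsManifold (𝓡 n) ∞ N]
  {m : ℕ} {M : Type*} [TopologicalSpace M] [ChartedSpace (EuclideanSpace ℝ (Fin m)) M]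

variable (m) in
/-- A section `W` of `φ^* TN` is `C^k` at `x`. -/
def ContMDiffAlongAt (k : WithTop ℕ∞) (φ : M → N) (W : ∀ y : M, TangentSpace (𝓡 n) (φ y)) (x : M) :
    Prop :=
  ContMDiffAt (𝓡 m) ((𝓡 n).prod 𝓘(ℝ, EuclideanSpace ℝ (Fin n))) k
    (fun y ↦ (⟨φ y, W y⟩ : TotalSpace (EuclideanSpace ℝ (Fin n)) (TangentSpace (𝓡 n) : N → Type _)))
    x

/-- The coordinates of a tangent vector at `p` in the preferred chart at `q`. -/
def chartCoord (q p : N) : TangentSpace (𝓡 n) p →L[ℝ] EuclideanSpace ℝ (Fin n) :=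
  (trivializationAt (EuclideanSpace ℝ (Fin n)) (TangentSpace (𝓡 n) : N → Type _)
    q).continuousLinearMapAt ℝ p

/-- The tangent vector at `p` with given coordinates in the preferred chart at `q`. -/
def chartVec (q p : N) : EuclideanSpace ℝ (Fin n) →L[ℝ] TangentSpace (𝓡 n) p :=
  (trivializationAt (EuclideanSpace ℝ (Fin n)) (TangentSpace (𝓡 n) : N → Type _) q).symmL ℝ p

lemma chartVec_chartCoord {q p : N} (hp : p ∈ (chartAt (EuclideanSpace ℝ (Fin n)) q).source)
    (v : TangentSpace (𝓡 n) p) : chartVec q p (chartCoord q p v) = v :=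
  Trivialization.symmL_continuousLinearMapAt _ (by simpa using hp) v

lemma chartCoord_chartVec {q p : N} (hp : p ∈ (chartAt (EuclideanSpace ℝ (Fin n)) q).source)
    (v : EuclideanSpace ℝ (Fin n)) : chartCoord q p (chartVec q p v) = v :=
  Trivialization.continuousLinearMapAt_symmL _ (by simpa using hp) v

lemma coordField_eq {q : N} (u : TangentSpace (𝓡 n) q) {p : N}
    (hp : p ∈ (chartAt (EuclideanSpace ℝ (Fin n)) q).source) :
    coordField u p = chartVec q p (chartCoord q q u) := by
  have : chartCoord q q u = (trivializationAt (EuclideanSpace ℝ (Fin n))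
      (TangentSpace (𝓡 n) : N → Type _) q ⟨q, u⟩).2 := by
    rw [chartCoord, Trivialization.continuousLinearMapAt_apply, Trivialization.coe_linearMapAt_of_mem]
    simp
  rw [this, coordField, FiberBundle.extend, chartVec,
    Trivialization.symmL_apply _ (by simpa using hp)]

lemma coordField_self {q : N} (u : TangentSpace (𝓡 n) q) : coordField u q = u :=
  FiberBundle.extend_apply_self _ u

lemma coordField_add {q : N} (u v : TangentSpace (𝓡 n) q) {p : N}
    (hp : p ∈ (chartAt (EuclideanSpace ℝ (Fin n)) q).source) :
    coordField (u + v) p = coordField u p + coordField v p := by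
  simp only [coordField_eq _ hp, map_add]

lemma coordField_smul {q : N} (c : ℝ) (u : TangentSpace (𝓡 n) q) {p : N}
    (hp : p ∈ (chartAt (EuclideanSpace ℝ (Fin n)) q).source) :
    coordField (c • u) p = c • coordField u p := by
  simp only [coordField_eq _ hp, map_smul]

lemma eventually_mem_chart {φ : M → N} {x : M} (hφ : ContinuousAt φ x) :
    ∀ᶠ y in 𝓝 x, φ y ∈ (chartAt (EuclideanSpace ℝ (Fin n)) (φ x)).source :=
  hφ ((chartAt _ (φ x)).open_source.mem_nhds (mem_chart_source _ _))

variable {k : WithTop ℕ∞} {φ : M → N} {W Z : ∀ y : M, TangentSpace (𝓡 n) (φ y)} {x : M}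

lemma ContMDiffAlongAt.base (h : ContMDiffAlongAt m k φ W x) : ContMDiffAt (𝓡 m) (𝓡 n) k φ x :=
  (contMDiffAt_totalSpace.1 h).1

lemma contMDiffAlongAt_iff (hφ : ContMDiffAt (𝓡 m) (𝓡 n) k φ x) :
    ContMDiffAlongAt m k φ W x ↔
      ContMDiffAt (𝓡 m) 𝓘(ℝ, EuclideanSpace ℝ (Fin n)) k (fun y ↦ chartCoord (φ x) (φ y) (W y)) x := by
  rw [ContMDiffAlongAt, contMDiffAt_totalSpace, and_iff_right hφ]
  refine Filter.EventuallyEq.contMDiffAt_iff ?_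
  filter_upwards [eventually_mem_chart (n := n) hφ.continuousAt] with y hy
  simp only [chartCoord]
  rw [Trivialization.continuousLinearMapAt_apply, Trivialization.coe_linearMapAt_of_mem]
  simpa using hy

lemma ContMDiffAlongAt.coord (h : ContMDiffAlongAt m k φ W x) :
    ContMDiffAt (𝓡 m) 𝓘(ℝ, EuclideanSpace ℝ (Fin n)) k (fun y ↦ chartCoord (φ x) (φ y) (W y)) x :=
  (contMDiffAlongAt_iff h.base).1 h

lemma ContMDiffAlongAt.congr (h : ContMDiffAlongAt m k φ W x) (hZ : ∀ᶠ y in 𝓝 x, Z y = W y) :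
    ContMDiffAlongAt m k φ Z x := by
  refine ContMDiffAt.congr_of_eventuallyEq h ?_
  filter_upwards [hZ] with y hy
  rw [hy]

lemma ContMDiffAlongAt.of_le {l : WithTop ℕ∞} (h : ContMDiffAlongAt m k φ W x) (hl : l ≤ k) :
    ContMDiffAlongAt m l φ W x :=
  ContMDiffAt.of_le h hl

lemma ContMDiffAlongAt.eventually [IsManifold (𝓡 m) ∞ M] (h : ContMDiffAlongAt m ∞ φ W x) :
    ∀ᶠ y in 𝓝 x, ContMDiffAlongAt m 1 φ W y := by
  have h1 : ContMDiffAlongAt m 1 φ W x := h.of_le (by simp)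
  exact (contMDiffAt_iff_contMDiffAt_nhds (n := 1) (by simp)).1 h1

lemma ContMDiffAlongAt.add (hW : ContMDiffAlongAt m k φ W x) (hZ : ContMDiffAlongAt m k φ Z x) :
    ContMDiffAlongAt m k φ (fun y ↦ W y + Z y) x := by
  rw [contMDiffAlongAt_iff hW.base]
  simp only [map_add]
  exact hW.coord.add hZ.coord

lemma ContMDiffAlongAt.smul {f : M → ℝ} (hf : ContMDiffAt (𝓡 m) 𝓘(ℝ, ℝ) k f x)
    (hW : ContMDiffAlongAt m k φ W x) :
    ContMDiffAlongAt m k φ (fun y ↦ f y • W y) x := by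
  rw [contMDiffAlongAt_iff hW.base]
  simp only [map_smul]
  exact hf.smul hW.coord

lemma ContMDiffAlongAt.const_smul (c : ℝ) (hW : ContMDiffAlongAt m k φ W x) :
    ContMDiffAlongAt m k φ (fun y ↦ c • W y) x :=
  .smul contMDiffAt_const hW

lemma ContMDiffAlongAt.sub (hW : ContMDiffAlongAt m k φ W x) (hZ : ContMDiffAlongAt m k φ Z x) :
    ContMDiffAlongAt m k φ (fun y ↦ W y - Z y) x := by
  rw [contMDiffAlongAt_iff hW.base]
  simp only [map_sub]
  exact hW.coord.sub hZ.coord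

lemma contMDiffAlongAt_zero (hφ : ContMDiffAt (𝓡 m) (𝓡 n) k φ x) :
    ContMDiffAlongAt m k φ (fun y ↦ (0 : TangentSpace (𝓡 n) (φ y))) x := by
  rw [contMDiffAlongAt_iff hφ]
  simp only [map_zero]
  exact contMDiffAt_const

lemma ContMDiffAlongAt.sum {ι : Type*} {s : Finset ι} {V : ι → ∀ y : M, TangentSpace (𝓡 n) (φ y)}
    (hφ : ContMDiffAt (𝓡 m) (𝓡 n) k φ x) (hV : ∀ i ∈ s, ContMDiffAlongAt m k φ (V i) x) :
    ContMDiffAlongAt m k φ (fun y ↦ ∑ i ∈ s, V i y) x := by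
  classical
  induction s using Finset.induction_on with
  | empty => simpa using contMDiffAlongAt_zero hφ
  | insert a s ha ih =>
    simp only [Finset.sum_insert ha]
    exact (hV a (Finset.mem_insert_self _ _)).add
      (ih fun i hi ↦ hV i (Finset.mem_insert_of_mem hi))

lemma contMDiffAlongAt_coordField {q : N} (u : TangentSpace (𝓡 n) q) {p : N} (hk : k ≤ ∞)
    (hp : p ∈ (chartAt (EuclideanSpace ℝ (Fin n)) q).source) :
    ContMDiffAlongAt n k (fun p : N ↦ p) (fun p ↦ coordField u p) p := by
  refine ContMDiffAlongAt.of_le (k := ∞) ?_ hk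
  let e := trivializationAt (EuclideanSpace ℝ (Fin n)) (TangentSpace (𝓡 n) : N → Type _) q
  refine (e.contMDiffAt_section_iff (IB := 𝓡 n) (by simpa [e] using hp)).2 ?_
  refine (contMDiffAt_const (c := chartCoord q q u)).congr_of_eventuallyEq ?_
  filter_upwards [(chartAt _ q).open_source.mem_nhds hp] with y hy
  rw [coordField_eq u hy, chartVec, Trivialization.symmL_apply _ (by simpa using hy)]
  exact congrArg Prod.snd (e.apply_mk_symm (by simpa [e] using hy) _)

/-- Composition of a `C^k` vector field with a `C^k` map. -/
lemma ContMDiffAlongAt.comp {Y : ∀ p : N, TangentSpace (𝓡 n) p}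
    (hY : ContMDiffAlongAt n k (fun p : N ↦ p) Y (φ x)) (hφ : ContMDiffAt (𝓡 m) (𝓡 n) k φ x) :
    ContMDiffAlongAt m k φ (fun y ↦ Y (φ y)) x :=
  ContMDiffAt.comp x hY hφ

/-- A basis of `T_q N`. -/
def tangentBasis (q : N) : Module.Basis (Fin n) ℝ (TangentSpace (𝓡 n) q) :=
  (EuclideanSpace.basisFun (Fin n) ℝ).toBasis

/-- The components of `W` near `x` with respect to the coordinate fields at `φ x`. -/
lemma ContMDiffAlongAt.exists_sum (hW : ContMDiffAlongAt m k φ W x) :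
    ∃ f : Fin n → M → ℝ, (∀ i, ContMDiffAt (𝓡 m) 𝓘(ℝ, ℝ) k (f i) x) ∧
      ∀ᶠ y in 𝓝 x, W y = ∑ i, f i y • coordField (tangentBasis (n := n) (φ x) i) (φ y) := by
  let b := tangentBasis (n := n) (φ x)
  let L : Fin n → EuclideanSpace ℝ (Fin n) →L[ℝ] ℝ := fun i ↦
    LinearMap.toContinuousLinearMap ((b.coord i) ∘ₗ (chartVec (n := n) (φ x) (φ x)).toLinearMap)
  refine ⟨fun i y ↦ L i (chartCoord (n := n) (φ x) (φ y) (W y)), fun i ↦ ?_, ?_⟩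
  · exact (L i).contDiff.contMDiff.contMDiffAt.comp x hW.coord
  · filter_upwards [eventually_mem_chart (n := n) hW.base.continuousAt] with y hy
    have h1 : ∑ i, L i (chartCoord (n := n) (φ x) (φ y) (W y)) • b i
        = chartVec (φ x) (φ x) (chartCoord (φ x) (φ y) (W y)) :=
      b.sum_repr (chartVec (φ x) (φ x) (chartCoord (φ x) (φ y) (W y)))
    have h2 := congrArg (fun z ↦ coordField (n := n) z (φ y)) h1
    simp only [coordField_eq _ hy, map_sum, map_smul] at h2 ⊢
    rw [h2, chartCoord_chartVec (mem_chart_source _ _), chartVec_chartCoord hy]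

end Sections

section Christoffel

variable {n : ℕ} {N : Type*} [TopologicalSpace N] [ChartedSpace (EuclideanSpace ℝ (Fin n)) N]
  [IsManifold (𝓡 n) ∞ N] [RiemannianBundle (fun q : N ↦ TangentSpace (𝓡 n) q)]
  [IsContMDiffRiemannianBundle (𝓡 n) ∞ (EuclideanSpace ℝ (Fin n))
    (fun q : N ↦ TangentSpace (𝓡 n) q)]
  {m : ℕ} {M : Type*} [TopologicalSpace M] [ChartedSpace (EuclideanSpace ℝ (Fin m)) M]

variable {k : WithTop ℕ∞} {φ : M → N} {W Z : ∀ y : M, TangentSpace (𝓡 n) (φ y)} {x : M}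

lemma ContMDiffAlongAt.inner_bundle (hk : k ≤ ∞) (hW : ContMDiffAlongAt m k φ W x)
    (hZ : ContMDiffAlongAt m k φ Z x) :
    ContMDiffAt (𝓡 m) 𝓘(ℝ, ℝ) k (fun y ↦ (inner ℝ (W y) (Z y) : ℝ)) x := by
  have : IsContMDiffRiemannianBundle (𝓡 n) k (EuclideanSpace ℝ (Fin n))
    (fun q : N ↦ TangentSpace (𝓡 n) q) := IsContMDiffRiemannianBundle.of_le (n := ∞) hk
  exact ContMDiffAt.inner_bundle (b := φ) hW hZ

variable {q : N}

lemma mdifferentiableAt_inner_coordField (w z : TangentSpace (𝓡 n) q) :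
    MDifferentiableAt (𝓡 n) 𝓘(ℝ, ℝ)
      (fun p : N ↦ (inner ℝ (coordField w p) (coordField z p) : ℝ)) q := by
  have h (u : TangentSpace (𝓡 n) q) := contMDiffAlongAt_coordField (k := 1) u (by simp)
    (mem_chart_source _ q)
  exact ((h w).inner_bundle (by simp) (h z)).mdifferentiableAt (by simp)

lemma mvfderiv_congr {F : Type*} [NormedAddCommGroup F] [NormedSpace ℝ F] {f g : M → F} {x : M}
    (h : f =ᶠ[𝓝 x] g) : mvfderiv (𝓡 m) f x = mvfderiv (𝓡 m) g x := by
  have := h.mfderiv_eq (I := 𝓡 m) (I' := 𝓘(ℝ, F))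
  ext v
  rw [mvfderiv, mvfderiv, h.eq_of_nhds]
  simp [this]

lemma metricDeriv_comm (u w z : TangentSpace (𝓡 n) q) : metricDeriv u w z = metricDeriv u z w := by
  simp only [metricDeriv, real_inner_comm]

lemma metricDeriv_add_dir (u u' w z : TangentSpace (𝓡 n) q) :
    metricDeriv (u + u') w z = metricDeriv u w z + metricDeriv u' w z := by
  simp only [metricDeriv, map_add]

lemma metricDeriv_smul_dir (c : ℝ) (u w z : TangentSpace (𝓡 n) q) :
    metricDeriv (c • u) w z = c * metricDeriv u w z := by
  simp only [metricDeriv, map_smul, smul_eq_mul]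

lemma metricDeriv_add_left (u w w' z : TangentSpace (𝓡 n) q) :
    metricDeriv u (w + w') z = metricDeriv u w z + metricDeriv u w' z := by
  have : (fun p : N ↦ (inner ℝ (coordField (w + w') p) (coordField z p) : ℝ)) =ᶠ[𝓝 q]
      fun p ↦ inner ℝ (coordField w p) (coordField z p)
        + inner ℝ (coordField w' p) (coordField z p) := by
    filter_upwards [eventually_mem_chart (n := n) (φ := fun p : N ↦ p) continuousAt_id] with p hp
    rw [coordField_add _ _ hp, inner_add_left]
  simp only [metricDeriv]
  rw [mvfderiv_congr this, mvfderiv_fun_add (mdifferentiableAt_inner_coordField _ _)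
    (mdifferentiableAt_inner_coordField _ _)]
  rfl

lemma metricDeriv_smul_left (c : ℝ) (u w z : TangentSpace (𝓡 n) q) :
    metricDeriv u (c • w) z = c * metricDeriv u w z := by
  have : (fun p : N ↦ (inner ℝ (coordField (c • w) p) (coordField z p) : ℝ)) =ᶠ[𝓝 q]
      fun p ↦ c * inner ℝ (coordField w p) (coordField z p) := by
    filter_upwards [eventually_mem_chart (n := n) (φ := fun p : N ↦ p) continuousAt_id] with p hp
    rw [coordField_smul _ _ hp, real_inner_smul_left]
  simp only [metricDeriv]
  rw [mvfderiv_congr this, mvfderiv_fun_mul mdifferentiableAt_const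
    (mdifferentiableAt_inner_coordField _ _), mvfderiv_const]
  simp

/-- The Koszul formula. -/
lemma inner_christoffel (u w z : TangentSpace (𝓡 n) q) :
    inner ℝ (christoffel u w) z
      = (metricDeriv u w z + metricDeriv w u z - metricDeriv z u w) / 2 := by
  let L : TangentSpace (𝓡 n) q →ₗ[ℝ] ℝ :=
    { toFun := fun z ↦ (metricDeriv u w z + metricDeriv w u z - metricDeriv z u w) / 2
      map_add' := fun a b ↦ by
        rw [metricDeriv_comm u w, metricDeriv_comm w u, metricDeriv_add_left,
          metricDeriv_add_left, metricDeriv_add_dir, metricDeriv_comm u w a,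
          metricDeriv_comm u w b, metricDeriv_comm w u a, metricDeriv_comm w u b]
        ring
      map_smul' := fun c a ↦ by
        rw [metricDeriv_comm u w, metricDeriv_comm w u, metricDeriv_smul_left,
          metricDeriv_smul_left, metricDeriv_smul_dir, metricDeriv_comm u w a,
          metricDeriv_comm w u a]
        simp only [RingHom.id_apply, smul_eq_mul]
        ring }
  let e := stdOrthonormalBasis ℝ (TangentSpace (𝓡 n) q)
  change inner ℝ (∑ i, L (e i) • e i) z = L z
  conv_rhs => rw [← e.sum_repr z]
  rw [sum_inner, map_sum]
  refine Finset.sum_congr rfl fun i _ ↦ ?_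
  rw [real_inner_smul_left, map_smul, e.repr_apply_apply, smul_eq_mul, mul_comm]

lemma christoffel_comm (u w : TangentSpace (𝓡 n) q) : christoffel u w = christoffel w u := by
  refine ext_inner_right ℝ fun z ↦ ?_
  rw [inner_christoffel, inner_christoffel, metricDeriv_comm z]
  ring

lemma christoffel_add_left (u u' w : TangentSpace (𝓡 n) q) :
    christoffel (u + u') w = christoffel u w + christoffel u' w := by
  refine ext_inner_right ℝ fun z ↦ ?_
  rw [inner_add_left]
  simp only [inner_christoffel, metricDeriv_add_dir, metricDeriv_add_left]
  ring

lemma christoffel_smul_left (c : ℝ) (u w : TangentSpace (𝓡 n) q) :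
    christoffel (c • u) w = c • christoffel u w := by
  refine ext_inner_right ℝ fun z ↦ ?_
  rw [real_inner_smul_left]
  simp only [inner_christoffel, metricDeriv_smul_dir, metricDeriv_smul_left]
  ring

lemma christoffel_add_right (u w w' : TangentSpace (𝓡 n) q) :
    christoffel u (w + w') = christoffel u w + christoffel u w' := by
  rw [christoffel_comm, christoffel_add_left, christoffel_comm w, christoffel_comm w']

lemma christoffel_smul_right (c : ℝ) (u w : TangentSpace (𝓡 n) q) :
    christoffel u (c • w) = c • christoffel u w := by
  rw [christoffel_comm, christoffel_smul_left, christoffel_comm w]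

lemma metricDeriv_eq_inner_christoffel (u w z : TangentSpace (𝓡 n) q) :
    metricDeriv u w z = inner ℝ (christoffel u w) z + inner ℝ w (christoffel u z) := by
  rw [real_inner_comm _ w, inner_christoffel, inner_christoffel, metricDeriv_comm u z,
    metricDeriv_comm z u w, metricDeriv_comm w u z]
  ring

end Christoffel

section CovDeriv

variable {n : ℕ} {N : Type*} [TopologicalSpace N] [ChartedSpace (EuclideanSpace ℝ (Fin n)) N]
  [IsManifold (𝓡 n) ∞ N] [RiemannianBundle (fun q : N ↦ TangentSpace (𝓡 n) q)]
  [IsContMDiffRiemannianBundle (𝓡 n) ∞ (EuclideanSpace ℝ (Fin n))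
    (fun q : N ↦ TangentSpace (𝓡 n) q)]
  {m : ℕ} {M : Type*} [TopologicalSpace M] [ChartedSpace (EuclideanSpace ℝ (Fin m)) M]
  [IsManifold (𝓡 m) ∞ M]
  {φ : M → N} {W Z : ∀ y : M, TangentSpace (𝓡 n) (φ y)} {x : M}

lemma covDerivAlong_eq (v : TangentSpace (𝓡 m) x) :
    covDerivAlong φ W v = chartVec (φ x) (φ x)
        (mvfderiv (𝓡 m) (fun y : M ↦ chartCoord (φ x) (φ y) (W y)) x v)
      + christoffel (mfderiv (𝓡 m) (𝓡 n) φ x v) (W x) := rfl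

lemma covDerivAlong_congr (h : ∀ᶠ y in 𝓝 x, W y = Z y) (v : TangentSpace (𝓡 m) x) :
    covDerivAlong φ W v = covDerivAlong φ Z v := by
  have : (fun y : M ↦ chartCoord (φ x) (φ y) (W y)) =ᶠ[𝓝 x]
      fun y : M ↦ chartCoord (φ x) (φ y) (Z y) := by
    filter_upwards [h] with y hy
    rw [hy]
  rw [covDerivAlong_eq, covDerivAlong_eq, mvfderiv_congr this, h.self_of_nhds]

lemma covDerivAlong_vec_add (u v : TangentSpace (𝓡 m) x) :
    covDerivAlong φ W (u + v) = covDerivAlong φ W u + covDerivAlong φ W v := by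
  simp only [covDerivAlong_eq, map_add, christoffel_add_left]
  abel

lemma covDerivAlong_vec_smul (c : ℝ) (v : TangentSpace (𝓡 m) x) :
    covDerivAlong φ W (c • v) = c • covDerivAlong φ W v := by
  simp only [covDerivAlong_eq, map_smul, christoffel_smul_left, smul_add]

variable (φ W x) in
/-- `v ↦ ∇^φ_v W` as a linear map. -/
def covDerivLinear : TangentSpace (𝓡 m) x →ₗ[ℝ] TangentSpace (𝓡 n) (φ x) where
  toFun v := covDerivAlong φ W v
  map_add' := covDerivAlong_vec_add
  map_smul' := covDerivAlong_vec_smul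

lemma covDerivAlong_vec_sum {ι : Type*} (s : Finset ι) (v : ι → TangentSpace (𝓡 m) x) :
    covDerivAlong φ W (∑ i ∈ s, v i) = ∑ i ∈ s, covDerivAlong φ W (v i) :=
  map_sum (covDerivLinear φ W x) _ _

lemma ContMDiffAlongAt.mdifferentiableAt_coord (hW : ContMDiffAlongAt m 1 φ W x) :
    MDifferentiableAt (𝓡 m) 𝓘(ℝ, EuclideanSpace ℝ (Fin n))
      (fun y ↦ chartCoord (φ x) (φ y) (W y)) x :=
  hW.coord.mdifferentiableAt (by simp)

lemma covDerivAlong_add (hW : ContMDiffAlongAt m 1 φ W x) (hZ : ContMDiffAlongAt m 1 φ Z x)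
    (v : TangentSpace (𝓡 m) x) :
    covDerivAlong φ (fun y ↦ W y + Z y) v = covDerivAlong φ W v + covDerivAlong φ Z v := by
  simp only [covDerivAlong_eq, map_add, christoffel_add_right]
  rw [mvfderiv_fun_add hW.mdifferentiableAt_coord hZ.mdifferentiableAt_coord,
    add_apply, map_add]
  abel

lemma covDerivAlong_smul {f : M → ℝ} (hf : ContMDiffAt (𝓡 m) 𝓘(ℝ, ℝ) 1 f x)
    (hW : ContMDiffAlongAt m 1 φ W x) (v : TangentSpace (𝓡 m) x) :
    covDerivAlong φ (fun y ↦ f y • W y) v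
      = f x • covDerivAlong φ W v + mvfderiv (𝓡 m) f x v • W x := by
  simp only [covDerivAlong_eq, map_smul, christoffel_smul_right]
  rw [mvfderiv_fun_smul (hf.mdifferentiableAt (by simp)) hW.mdifferentiableAt_coord]
  simp only [add_apply, smul_apply,
    ContinuousLinearMap.smulRight_apply, map_add, map_smul,
    chartVec_chartCoord (mem_chart_source _ (φ x)), smul_add]
  abel

lemma covDerivAlong_zero (hφ : ContMDiffAt (𝓡 m) (𝓡 n) 1 φ x) (v : TangentSpace (𝓡 m) x) :
    covDerivAlong φ (fun y ↦ (0 : TangentSpace (𝓡 n) (φ y))) v = 0 := by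
  have := covDerivAlong_add (contMDiffAlongAt_zero hφ) (contMDiffAlongAt_zero hφ) v
  simpa using this

lemma covDerivAlong_sum {ι : Type*} {s : Finset ι} {V : ι → ∀ y : M, TangentSpace (𝓡 n) (φ y)}
    (hφ : ContMDiffAt (𝓡 m) (𝓡 n) 1 φ x) (hV : ∀ i ∈ s, ContMDiffAlongAt m 1 φ (V i) x)
    (v : TangentSpace (𝓡 m) x) :
    covDerivAlong φ (fun y ↦ ∑ i ∈ s, V i y) v = ∑ i ∈ s, covDerivAlong φ (V i) v := by
  classical
  induction s using Finset.induction_on with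
  | empty => simpa using covDerivAlong_zero hφ v
  | insert a s ha ih =>
    have hs : ∀ i ∈ s, ContMDiffAlongAt m 1 φ (V i) x :=
      fun i hi ↦ hV i (Finset.mem_insert_of_mem hi)
    simp only [Finset.sum_insert ha]
    rw [covDerivAlong_add (hV a (Finset.mem_insert_self _ _)) (.sum hφ hs), ih hs]

lemma covDerivAlong_sum_smul {ι : Type*} {s : Finset ι} {f : ι → M → ℝ}
    {V : ι → ∀ y : M, TangentSpace (𝓡 n) (φ y)}
    (hφ : ContMDiffAt (𝓡 m) (𝓡 n) 1 φ x) (hf : ∀ i ∈ s, ContMDiffAt (𝓡 m) 𝓘(ℝ, ℝ) 1 (f i) x)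
    (hV : ∀ i ∈ s, ContMDiffAlongAt m 1 φ (V i) x) (v : TangentSpace (𝓡 m) x) :
    covDerivAlong φ (fun y ↦ ∑ i ∈ s, f i y • V i y) v
      = ∑ i ∈ s, (f i x • covDerivAlong φ (V i) v + mvfderiv (𝓡 m) (f i) x v • V i x) := by
  rw [covDerivAlong_sum hφ fun i hi ↦ (hV i hi).smul (hf i hi)]
  exact Finset.sum_congr rfl fun i hi ↦ covDerivAlong_smul (hf i hi) (hV i hi) v

/-- The chain rule for functions with values in a vector space. -/
lemma mvfderiv_comp_of_contMDiffAt {F : Type*} [NormedAddCommGroup F] [NormedSpace ℝ F] {g : N → F}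
    (hg : MDifferentiableAt (𝓡 n) 𝓘(ℝ, F) g (φ x)) (hφ : ContMDiffAt (𝓡 m) (𝓡 n) 1 φ x)
    (v : TangentSpace (𝓡 m) x) :
    mvfderiv (𝓡 m) (fun y ↦ g (φ y)) x v
      = mvfderiv (𝓡 n) g (φ x) (mfderiv (𝓡 m) (𝓡 n) φ x v) :=
  mfderiv_comp_apply x hg (hφ.mdifferentiableAt (by simp)) v

/-- The induced connection on restrictions of vector fields of the target. -/
lemma covDerivAlong_comp {Y : ∀ p : N, TangentSpace (𝓡 n) p}
    (hY : ContMDiffAlongAt n 1 (fun p : N ↦ p) Y (φ x)) (hφ : ContMDiffAt (𝓡 m) (𝓡 n) 1 φ x)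
    (v : TangentSpace (𝓡 m) x) :
    covDerivAlong φ (fun y ↦ Y (φ y)) v = leviCivita Y (mfderiv (𝓡 m) (𝓡 n) φ x v) := by
  rw [leviCivita, covDerivAlong_eq, covDerivAlong_eq]
  rw [mvfderiv_comp_of_contMDiffAt (g := fun p ↦ chartCoord (φ x) p (Y p))
    hY.mdifferentiableAt_coord hφ]
  congr 2
  exact (congrArg (fun L ↦ L (mfderiv (𝓡 m) (𝓡 n) φ x v))
    (mfderiv_id (I := 𝓡 n) (x := φ x))).symm

lemma leviCivita_coordField {q : N} (u w : TangentSpace (𝓡 n) q) :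
    leviCivita (coordField w) u = christoffel u w := by
  have : (fun p : N ↦ chartCoord q p (coordField w p)) =ᶠ[𝓝 q] fun _ ↦ chartCoord q q w := by
    filter_upwards [eventually_mem_chart (n := n) (φ := fun p : N ↦ p) continuousAt_id] with p hp
    rw [coordField_eq _ hp, chartCoord_chartVec hp]
  rw [leviCivita, covDerivAlong_eq, mvfderiv_congr this, mvfderiv_const, coordField_self]
  simp only [zero_apply, map_zero, zero_add]
  congr 1
  exact congrArg (fun L ↦ L u) (mfderiv_id (I := 𝓡 n) (x := q))

variable (m φ W Z x) in
/-- Compatibility with the metric at `x`, for a pair of sections. -/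
def IsMetricPairAt : Prop :=
  ∀ v : TangentSpace (𝓡 m) x, mvfderiv (𝓡 m) (fun y ↦ (inner ℝ (W y) (Z y) : ℝ)) x v
      = inner ℝ (covDerivAlong φ W v) (Z x) + inner ℝ (W x) (covDerivAlong φ Z v)

lemma IsMetricPairAt.symm (h : IsMetricPairAt m φ W Z x) : IsMetricPairAt m φ Z W x := by
  intro v
  have := h v
  simp only [real_inner_comm] at this ⊢
  rw [this, add_comm]

lemma IsMetricPairAt.congr {W' : ∀ y : M, TangentSpace (𝓡 n) (φ y)} (h : IsMetricPairAt m φ W Z x)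
    (hW : ∀ᶠ y in 𝓝 x, W' y = W y) : IsMetricPairAt m φ W' Z x := by
  intro v
  have h1 : (fun y ↦ (inner ℝ (W' y) (Z y) : ℝ)) =ᶠ[𝓝 x] fun y ↦ inner ℝ (W y) (Z y) := by
    filter_upwards [hW] with y hy
    rw [hy]
  rw [mvfderiv_congr h1, h v, covDerivAlong_congr hW, hW.self_of_nhds]

lemma IsMetricPairAt.add {W' : ∀ y : M, TangentSpace (𝓡 n) (φ y)}
    (hW : ContMDiffAlongAt m 1 φ W x) (hW' : ContMDiffAlongAt m 1 φ W' x)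
    (hZ : ContMDiffAlongAt m 1 φ Z x) (h : IsMetricPairAt m φ W Z x) (h' : IsMetricPairAt m φ W' Z x) :
    IsMetricPairAt m φ (fun y ↦ W y + W' y) Z x := by
  intro v
  simp only [inner_add_left]
  rw [mvfderiv_fun_add ((hW.inner_bundle (by simp) hZ).mdifferentiableAt (by simp))
    ((hW'.inner_bundle (by simp) hZ).mdifferentiableAt (by simp)), add_apply, h v, h' v,
    covDerivAlong_add hW hW', inner_add_left]
  ring

lemma IsMetricPairAt.smul {f : M → ℝ} (hf : ContMDiffAt (𝓡 m) 𝓘(ℝ, ℝ) 1 f x)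
    (hW : ContMDiffAlongAt m 1 φ W x) (hZ : ContMDiffAlongAt m 1 φ Z x)
    (h : IsMetricPairAt m φ W Z x) : IsMetricPairAt m φ (fun y ↦ f y • W y) Z x := by
  intro v
  simp only [real_inner_smul_left]
  rw [mvfderiv_fun_mul (hf.mdifferentiableAt (by simp))
    ((hW.inner_bundle (by simp) hZ).mdifferentiableAt (by simp)), add_apply, smul_apply, smul_apply, h v,
    covDerivAlong_smul hf hW, inner_add_left, real_inner_smul_left, real_inner_smul_left]
  simp only [smul_eq_mul]
  ring

lemma ContMDiffAlongAt.coordField_comp (hφ : ContMDiffAt (𝓡 m) (𝓡 n) 1 φ x)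
    (u : TangentSpace (𝓡 n) (φ x)) : ContMDiffAlongAt m 1 φ (fun y ↦ coordField u (φ y)) x :=
  (contMDiffAlongAt_coordField u (by simp) (mem_chart_source _ _)).comp hφ

lemma isMetricPairAt_of_coordField (hW : ContMDiffAlongAt m 1 φ W x)
    (hZ : ContMDiffAlongAt m 1 φ Z x)
    (h : ∀ u : TangentSpace (𝓡 n) (φ x), IsMetricPairAt m φ (fun y ↦ coordField u (φ y)) Z x) :
    IsMetricPairAt m φ W Z x := by
  classical
  obtain ⟨f, hf, hfW⟩ := hW.exists_sum
  refine IsMetricPairAt.congr ?_ hfW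
  generalize (Finset.univ : Finset (Fin n)) = s
  have hE (i : Fin n) := ContMDiffAlongAt.coordField_comp hW.base (tangentBasis (n := n) (φ x) i)
  induction s using Finset.induction_on with
  | empty =>
    intro v
    simp only [Finset.sum_empty, inner_zero_left, covDerivAlong_zero hW.base]
    rw [mvfderiv_const]
    simp
  | insert a s ha ih =>
    simp only [Finset.sum_insert ha]
    exact IsMetricPairAt.add ((hE a).smul (hf a)) (.sum hW.base fun i _ ↦ (hE i).smul (hf i)) hZ
      ((h _).smul (hf a) (hE a) hZ) ih

/-- The induced connection is compatible with the metric. -/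
lemma mvfderiv_inner (hW : ContMDiffAlongAt m 1 φ W x) (hZ : ContMDiffAlongAt m 1 φ Z x)
    (v : TangentSpace (𝓡 m) x) :
    mvfderiv (𝓡 m) (fun y ↦ (inner ℝ (W y) (Z y) : ℝ)) x v
      = inner ℝ (covDerivAlong φ W v) (Z x) + inner ℝ (W x) (covDerivAlong φ Z v) := by
  refine isMetricPairAt_of_coordField hW hZ (fun u ↦ IsMetricPairAt.symm ?_) v
  refine isMetricPairAt_of_coordField hZ (.coordField_comp hW.base u) fun w v ↦ ?_
  have hE (u : TangentSpace (𝓡 n) (φ x)) :=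
    contMDiffAlongAt_coordField (k := 1) u (by simp) (mem_chart_source _ (φ x))
  rw [covDerivAlong_comp (hE _) hW.base, covDerivAlong_comp (hE _) hW.base,
    leviCivita_coordField, leviCivita_coordField]
  beta_reduce
  rw [coordField_self, coordField_self, ← metricDeriv_eq_inner_christoffel]
  exact mvfderiv_comp_of_contMDiffAt
    (g := fun p ↦ (inner ℝ (coordField w p) (coordField u p) : ℝ))
    (mdifferentiableAt_inner_coordField w u) hW.base v

end CovDeriv

section SecondDerivativeTest

lemma deriv_deriv_nonpos_of_isLocalMax {g : ℝ → ℝ} {t : ℝ} (h : IsLocalMax g t)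
    (hg : ContinuousAt g t) : deriv (deriv g) t ≤ 0 := by
  by_contra! hpos
  have hmin := isLocalMin_of_deriv_deriv_pos hpos h.deriv_eq_zero hg
  have hconst : g =ᶠ[𝓝 t] fun _ ↦ g t := by
    filter_upwards [h, hmin] with s hs hs'
    exact le_antisymm hs hs'
  have h0 : deriv g =ᶠ[𝓝 t] fun _ ↦ 0 := by
    filter_upwards [hconst.eventuallyEq_nhds] with s hs
    rw [hs.deriv_eq, deriv_const]
  rw [h0.deriv_eq, deriv_const] at hpos
  exact lt_irrefl _ hpos

lemma fderiv_fderiv_nonpos_of_isLocalMax {E : Type*} [NormedAddCommGroup E] [NormedSpace ℝ E]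
    {h : E → ℝ} {p : E} (hmax : IsLocalMax h p) (hh : ContDiffAt ℝ 2 h p) (v : E) :
    fderiv ℝ (fderiv ℝ h) p v v ≤ 0 := by
  let c : ℝ → E := fun t ↦ p + t • v
  have hc (t : ℝ) : HasDerivAt c v t := by
    simpa [c] using ((hasDerivAt_id t).smul_const v).const_add p
  have hc0 : c 0 = p := by simp [c]
  have hcc : ContinuousAt c 0 := (hc 0).continuousAt
  have hev : deriv (h ∘ c) =ᶠ[𝓝 0] fun t ↦ fderiv ℝ h (c t) v := by
    have : ∀ᶠ q in 𝓝 (c 0), ContDiffAt ℝ 2 h q := by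
      rw [hc0]
      exact hh.eventually (by simp)
    filter_upwards [hcc.eventually this] with t ht
    exact ((ht.differentiableAt (by simp)).hasFDerivAt.comp_hasDerivAt t (hc t)).deriv
  have hD : DifferentiableAt ℝ (fderiv ℝ h) (c 0) := by
    rw [hc0]
    exact (hh.fderiv_right (m := 1) (by norm_num)).differentiableAt (by simp)
  have h2 : deriv (deriv (h ∘ c)) 0 = fderiv ℝ (fderiv ℝ h) p v v := by
    rw [hev.deriv_eq]
    have := (hD.hasFDerivAt.comp_hasDerivAt 0 (hc 0)).clm_apply (hasDerivAt_const 0 v)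
    rw [hc0] at this
    simpa using this.deriv
  rw [← h2]
  refine deriv_deriv_nonpos_of_isLocalMax ?_ ?_
  · exact IsLocalMax.comp_continuous (by rwa [hc0]) hcc
  · exact ContinuousAt.comp (by rw [hc0]; exact hh.continuousAt) hcc

end SecondDerivativeTest

section CoordinateDerivatives

variable {m : ℕ} {M : Type*} [TopologicalSpace M] [ChartedSpace (EuclideanSpace ℝ (Fin m)) M]
  [IsManifold (𝓡 m) ∞ M] {F : Type*} [NormedAddCommGroup F] [NormedSpace ℝ F]
  {f : M → F} {x y : M}

lemma coordField_eq_mfderiv (hy : y ∈ (chartAt (EuclideanSpace ℝ (Fin m)) x).source)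
    (a : TangentSpace (𝓡 m) x) :
    coordField a y = mfderiv 𝓘(ℝ, EuclideanSpace ℝ (Fin m)) (𝓡 m) (extChartAt (𝓡 m) x).symm
      (extChartAt (𝓡 m) x y) (chartCoord x x a) := by
  rw [coordField_eq a hy, chartVec, TangentBundle.symmL_trivializationAt hy,
    ModelWithCorners.Boundaryless.range_eq_univ, mfderivWithin_univ]
  rfl

lemma mdifferentiableAt_extChartAt_symm' (hy : y ∈ (chartAt (EuclideanSpace ℝ (Fin m)) x).source) :
    MDifferentiableAt 𝓘(ℝ, EuclideanSpace ℝ (Fin m)) (𝓡 m) (extChartAt (𝓡 m) x).symm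
      (extChartAt (𝓡 m) x y) := by
  have h := mdifferentiableWithinAt_extChartAt_symm (I := 𝓡 m)
    ((extChartAt (𝓡 m) x).map_source (by simpa using hy))
  rwa [ModelWithCorners.Boundaryless.range_eq_univ, mdifferentiableWithinAt_univ] at h

/-- The derivative along a coordinate field is a partial derivative in the chart. -/
lemma mvfderiv_coordField (hf : MDifferentiableAt (𝓡 m) 𝓘(ℝ, F) f y)
    (hy : y ∈ (chartAt (EuclideanSpace ℝ (Fin m)) x).source) (a : TangentSpace (𝓡 m) x) :
    mvfderiv (𝓡 m) f y (coordField a y)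
      = fderiv ℝ (f ∘ (extChartAt (𝓡 m) x).symm) (extChartAt (𝓡 m) x y) (chartCoord x x a) := by
  have hy' : y ∈ (extChartAt (𝓡 m) x).source := by simpa using hy
  rw [coordField_eq_mfderiv hy, ← mfderiv_eq_fderiv]
  have := mfderiv_comp_apply_of_eq (I := 𝓘(ℝ, EuclideanSpace ℝ (Fin m))) (I' := 𝓡 m)
    (I'' := 𝓘(ℝ, F)) (f := (extChartAt (𝓡 m) x).symm) (g := f) (extChartAt (𝓡 m) x y)
    hf (mdifferentiableAt_extChartAt_symm' hy) ((extChartAt (𝓡 m) x).left_inv hy')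
    (chartCoord x x a)
  exact this.symm

lemma contDiffAt_comp_extChartAt_symm {k : WithTop ℕ∞} (hk : k ≤ ∞)
    (hf : ContMDiffAt (𝓡 m) 𝓘(ℝ, F) k f y)
    (hy : y ∈ (chartAt (EuclideanSpace ℝ (Fin m)) x).source) :
    ContDiffAt ℝ k (f ∘ (extChartAt (𝓡 m) x).symm) (extChartAt (𝓡 m) x y) := by
  have hy' : y ∈ (extChartAt (𝓡 m) x).source := by simpa using hy
  rw [← contMDiffAt_iff_contDiffAt]
  refine ContMDiffAt.comp (I' := 𝓡 m) _ ?_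
    (((contMDiffOn_extChartAt_symm (n := ∞) x).contMDiffAt
      ((isOpen_extChartAt_target x).mem_nhds ((extChartAt (𝓡 m) x).map_source hy'))).of_le hk)
  rwa [(extChartAt (𝓡 m) x).left_inv hy']

/-- Iterated derivatives along coordinate fields are second partial derivatives in the chart. -/
lemma mvfderiv_mvfderiv_coordField (hf : ContMDiffAt (𝓡 m) 𝓘(ℝ, F) 2 f y)
    (hy : y ∈ (chartAt (EuclideanSpace ℝ (Fin m)) x).source) (a b : TangentSpace (𝓡 m) x) :
    mvfderiv (𝓡 m) (fun z ↦ mvfderiv (𝓡 m) f z (coordField a z)) y (coordField b y)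
      = fderiv ℝ (fderiv ℝ (f ∘ (extChartAt (𝓡 m) x).symm)) (extChartAt (𝓡 m) x y)
          (chartCoord x x b) (chartCoord x x a) := by
  set χ := extChartAt (𝓡 m) x with hχ
  set h := f ∘ χ.symm with hh
  have hy' : y ∈ χ.source := by simpa [hχ] using hy
  have hC : ContDiffAt ℝ 2 h (χ y) := contDiffAt_comp_extChartAt_symm (ENat.LEInfty.out) hf hy
  have hD : DifferentiableAt ℝ (fderiv ℝ h) (χ y) :=
    (hC.fderiv_right (m := 1) (by norm_num)).differentiableAt (by simp)
  have hD' : DifferentiableAt ℝ (fun z ↦ fderiv ℝ h z (chartCoord x x a)) (χ y) :=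
    hD.clm_apply (differentiableAt_const _)
  have hev : (fun z ↦ mvfderiv (𝓡 m) f z (coordField a z)) =ᶠ[𝓝 y]
      fun z ↦ fderiv ℝ h (χ z) (chartCoord x x a) := by
    filter_upwards [(contMDiffAt_iff_contMDiffAt_nhds (by simp)).1 hf,
      (chartAt _ x).open_source.mem_nhds hy] with z hz hzs
    exact mvfderiv_coordField (hz.mdifferentiableAt (by simp)) hzs a
  have hdiff : MDifferentiableAt (𝓡 m) 𝓘(ℝ, F) (fun z ↦ fderiv ℝ h (χ z) (chartCoord x x a)) y :=
    hD'.comp_mdifferentiableAt (mdifferentiableAt_extChartAt hy)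
  have hev2 : (fun z ↦ fderiv ℝ h (χ z) (chartCoord x x a)) ∘ χ.symm =ᶠ[𝓝 (χ y)]
      fun w ↦ fderiv ℝ h w (chartCoord x x a) := by
    filter_upwards [(isOpen_extChartAt_target x).mem_nhds (χ.map_source hy')] with w hw
    simp only [Function.comp_apply]
    rw [χ.right_inv hw]
  rw [mvfderiv_congr hev, mvfderiv_coordField hdiff hy, hev2.fderiv_eq,
    fderiv_clm_apply hD (differentiableAt_const _)]
  simp [hχ]

lemma mvfderiv_mvfderiv_coordField_comm (hf : ContMDiffAt (𝓡 m) 𝓘(ℝ, F) 2 f y)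
    (hy : y ∈ (chartAt (EuclideanSpace ℝ (Fin m)) x).source) (a b : TangentSpace (𝓡 m) x) :
    mvfderiv (𝓡 m) (fun z ↦ mvfderiv (𝓡 m) f z (coordField a z)) y (coordField b y)
      = mvfderiv (𝓡 m) (fun z ↦ mvfderiv (𝓡 m) f z (coordField b z)) y (coordField a y) := by
  rw [mvfderiv_mvfderiv_coordField hf hy, mvfderiv_mvfderiv_coordField hf hy]
  exact (contDiffAt_comp_extChartAt_symm (k := 2) (ENat.LEInfty.out) hf
    hy).isSymmSndFDerivAt (by simp) _ _

/-- The first derivative test. -/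
lemma mvfderiv_eq_zero_of_isLocalMax {f : M → ℝ} (h : IsLocalMax f x)
    (hf : ContMDiffAt (𝓡 m) 𝓘(ℝ, ℝ) 2 f x) (v : TangentSpace (𝓡 m) x) :
    mvfderiv (𝓡 m) f x v = 0 := by
  have h1 : IsLocalMax (f ∘ (extChartAt (𝓡 m) x).symm) (extChartAt (𝓡 m) x x) := by
    refine IsLocalMax.comp_continuous (g := (extChartAt (𝓡 m) x).symm) (f := f)
      (b := extChartAt (𝓡 m) x x) ?_ (continuousAt_extChartAt_symm x)
    rwa [extChartAt_to_inv]
  conv_lhs => rw [← coordField_self v]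
  rw [mvfderiv_coordField (hf.mdifferentiableAt (by simp)) (mem_chart_source _ x),
    h1.fderiv_eq_zero]
  rfl

/-- The second derivative test. -/
lemma mvfderiv_mvfderiv_nonpos_of_isLocalMax {f : M → ℝ} (h : IsLocalMax f x)
    (hf : ContMDiffAt (𝓡 m) 𝓘(ℝ, ℝ) 2 f x) (v : TangentSpace (𝓡 m) x) :
    mvfderiv (𝓡 m) (fun z ↦ mvfderiv (𝓡 m) f z (coordField v z)) x v ≤ 0 := by
  set χ := extChartAt (𝓡 m) x with hχ
  have h1 : IsLocalMax (f ∘ χ.symm) (χ x) := by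
    refine IsLocalMax.comp_continuous (g := χ.symm) (f := f) (b := χ x) ?_
      (continuousAt_extChartAt_symm x)
    rwa [extChartAt_to_inv]
  have := mvfderiv_mvfderiv_coordField hf (mem_chart_source _ x) v v
  rw [coordField_self] at this
  rw [this]
  exact fderiv_fderiv_nonpos_of_isLocalMax h1
    (contDiffAt_comp_extChartAt_symm ENat.LEInfty.out hf (mem_chart_source _ x)) _

end CoordinateDerivatives

section Symmetry

variable {n : ℕ} {N : Type*} [TopologicalSpace N] [ChartedSpace (EuclideanSpace ℝ (Fin n)) N]
  [IsManifold (𝓡 n) ∞ N] [RiemannianBundle (fun q : N ↦ TangentSpace (𝓡 n) q)]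
  [IsContMDiffRiemannianBundle (𝓡 n) ∞ (EuclideanSpace ℝ (Fin n))
    (fun q : N ↦ TangentSpace (𝓡 n) q)]
  {m : ℕ} {M : Type*} [TopologicalSpace M] [ChartedSpace (EuclideanSpace ℝ (Fin m)) M]
  [IsManifold (𝓡 m) ∞ M] {φ : M → N} {x y : M}

/-- The induced connection is torsion-free. -/
lemma covDerivAlong_mfderiv_coordField_comm (hφ : ContMDiffAt (𝓡 m) (𝓡 n) 2 φ y)
    (hy : y ∈ (chartAt (EuclideanSpace ℝ (Fin m)) x).source) (a b : TangentSpace (𝓡 m) x) :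
    covDerivAlong φ (fun z ↦ mfderiv (𝓡 m) (𝓡 n) φ z (coordField a z)) (coordField b y)
      = covDerivAlong φ (fun z ↦ mfderiv (𝓡 m) (𝓡 n) φ z (coordField b z)) (coordField a y) := by
  have hψ : ContMDiffAt (𝓡 m) 𝓘(ℝ, EuclideanSpace ℝ (Fin n)) 2
      (fun z ↦ extChartAt (𝓡 n) (φ y) (φ z)) y :=
    ContMDiffAt.comp y (contMDiffAt_extChartAt.of_le (n := ∞) (ENat.LEInfty.out)) hφ
  have key (c : TangentSpace (𝓡 m) x) :
      (fun z ↦ chartCoord (φ y) (φ z) (mfderiv (𝓡 m) (𝓡 n) φ z (coordField c z))) =ᶠ[𝓝 y]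
        fun z ↦ mvfderiv (𝓡 m) (fun z ↦ extChartAt (𝓡 n) (φ y) (φ z)) z (coordField c z) := by
    filter_upwards [(contMDiffAt_iff_contMDiffAt_nhds (by simp)).1 hφ,
      eventually_mem_chart (n := n) hφ.continuousAt] with z hz hzs
    rw [mvfderiv_comp_of_contMDiffAt (mdifferentiableAt_extChartAt hzs) (hz.of_le (by norm_num)),
      chartCoord, TangentBundle.continuousLinearMapAt_trivializationAt hzs]
    rfl
  rw [covDerivAlong_eq, covDerivAlong_eq, mvfderiv_congr (key a), mvfderiv_congr (key b),
    mvfderiv_mvfderiv_coordField_comm hψ hy, christoffel_comm]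

end Symmetry

section Frames

variable {n : ℕ} {N : Type*} [TopologicalSpace N] [ChartedSpace (EuclideanSpace ℝ (Fin n)) N]
  [IsManifold (𝓡 n) ∞ N] [RiemannianBundle (fun q : N ↦ TangentSpace (𝓡 n) q)]
  [IsContMDiffRiemannianBundle (𝓡 n) ∞ (EuclideanSpace ℝ (Fin n))
    (fun q : N ↦ TangentSpace (𝓡 n) q)]
  {m : ℕ} {M : Type*} [TopologicalSpace M] [ChartedSpace (EuclideanSpace ℝ (Fin m)) M]
  [IsManifold (𝓡 m) ∞ M] {φ : M → N} {W Z : ∀ y : M, TangentSpace (𝓡 n) (φ y)} {x : M}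
  {k : WithTop ℕ∞}

lemma ContMDiffAlongAt.gramSchmidt (hk : k ≤ ∞) {ι : Type*} [LinearOrder ι] [LocallyFiniteOrderBot ι]
    [WellFoundedLT ι] {V : ι → ∀ y : M, TangentSpace (𝓡 n) (φ y)}
    (hφ : ContMDiffAt (𝓡 m) (𝓡 n) k φ x) (hV : ∀ i, ContMDiffAlongAt m k φ (V i) x)
    (hli : LinearIndependent ℝ (fun i ↦ V i x)) (i : ι) :
    ContMDiffAlongAt m k φ (fun y ↦ InnerProductSpace.gramSchmidt ℝ (fun j ↦ V j y) i) x := by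
  induction i using WellFoundedLT.induction with
  | ind i ih =>
    have hproj (y : M) : InnerProductSpace.gramSchmidt ℝ (fun j ↦ V j y) i = V i y
        - ∑ j ∈ Finset.Iio i,
          (inner ℝ (InnerProductSpace.gramSchmidt ℝ (fun j ↦ V j y) j) (V i y)
            / inner ℝ (InnerProductSpace.gramSchmidt ℝ (fun j ↦ V j y) j)
              (InnerProductSpace.gramSchmidt ℝ (fun j ↦ V j y) j) : ℝ)
            • InnerProductSpace.gramSchmidt ℝ (fun j ↦ V j y) j := by
      rw [InnerProductSpace.gramSchmidt_def]
      congr 1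
      refine Finset.sum_congr rfl fun j _ ↦ ?_
      rw [Submodule.starProjection_singleton, real_inner_self_eq_norm_sq]
      rfl
    simp only [hproj]
    refine (hV i).sub (.sum hφ fun j hj ↦ ?_)
    have hj' := ih j (Finset.mem_Iio.1 hj)
    refine ContMDiffAlongAt.smul ?_ hj'
    refine ContMDiffAt.div₀ (hj'.inner_bundle hk (hV i)) (hj'.inner_bundle hk hj') ?_
    rw [inner_self_ne_zero]
    exact InnerProductSpace.gramSchmidt_ne_zero j hli

lemma ContMDiffAlongAt.gramSchmidtNormed (hk : k ≤ ∞) {ι : Type*} [LinearOrder ι]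
    [LocallyFiniteOrderBot ι] [WellFoundedLT ι] {V : ι → ∀ y : M, TangentSpace (𝓡 n) (φ y)}
    (hφ : ContMDiffAt (𝓡 m) (𝓡 n) k φ x) (hV : ∀ i, ContMDiffAlongAt m k φ (V i) x)
    (hli : LinearIndependent ℝ (fun i ↦ V i x)) (i : ι) :
    ContMDiffAlongAt m k φ (fun y ↦ InnerProductSpace.gramSchmidtNormed ℝ (fun j ↦ V j y) i) x := by
  have h := ContMDiffAlongAt.gramSchmidt hk hφ hV hli i
  have hne : inner ℝ (InnerProductSpace.gramSchmidt ℝ (fun j ↦ V j x) i)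
      (InnerProductSpace.gramSchmidt ℝ (fun j ↦ V j x) i) ≠ (0 : ℝ) := by
    rw [inner_self_ne_zero]
    exact InnerProductSpace.gramSchmidt_ne_zero i hli
  have hs : ContMDiffAt (𝓡 m) 𝓘(ℝ, ℝ) k (fun y ↦ (Real.sqrt (inner ℝ
      (InnerProductSpace.gramSchmidt ℝ (fun j ↦ V j y) i)
      (InnerProductSpace.gramSchmidt ℝ (fun j ↦ V j y) i)))⁻¹) x := by
    have h1 : ContDiffAt ℝ k (fun t : ℝ ↦ (Real.sqrt t)⁻¹) (inner ℝ
        (InnerProductSpace.gramSchmidt ℝ (fun j ↦ V j x) i)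
        (InnerProductSpace.gramSchmidt ℝ (fun j ↦ V j x) i)) := by
      refine (Real.contDiffAt_sqrt hne).inv (Real.sqrt_ne_zero'.2 ?_)
      exact lt_of_le_of_ne real_inner_self_nonneg hne.symm
    exact ContMDiffAt.comp (I' := 𝓘(ℝ, ℝ)) (g := fun t : ℝ ↦ (Real.sqrt t)⁻¹) x h1.contMDiffAt
      (h.inner_bundle hk h)
  refine (ContMDiffAlongAt.smul hs h).congr (Filter.Eventually.of_forall fun y ↦ ?_)
  rw [InnerProductSpace.gramSchmidtNormed, real_inner_self_eq_norm_sq,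
    Real.sqrt_sq (norm_nonneg _)]
  rfl

lemma linearIndependent_coordField {q p : N} {ι : Type*} {u : ι → TangentSpace (𝓡 n) q}
    (hp : p ∈ (chartAt (EuclideanSpace ℝ (Fin n)) q).source) (hu : LinearIndependent ℝ u) :
    LinearIndependent ℝ (fun i ↦ coordField (u i) p) := by
  have h1 : (fun i ↦ coordField (u i) p)
      = ((chartVec q p).toLinearMap ∘ₗ (chartCoord q q).toLinearMap) ∘ u := by
    ext i : 1
    exact coordField_eq _ hp
  rw [h1]
  refine hu.map' _ (LinearMap.ker_eq_bot.2 ?_)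
  rw [LinearMap.coe_comp]
  refine Function.Injective.comp ?_ ?_
  · exact Function.LeftInverse.injective (chartCoord_chartVec hp)
  · exact Function.LeftInverse.injective (chartVec_chartCoord (mem_chart_source _ q))

/-- Local smooth orthonormal frames exist. -/
lemma exists_orthonormalFrame (q : N) :
    ∃ G : Fin n → ∀ p : N, TangentSpace (𝓡 n) p,
      (∀ i, ContMDiffAlongAt n ∞ (fun p : N ↦ p) (G i) q) ∧
      ∀ᶠ p in 𝓝 q, Orthonormal ℝ (fun i ↦ G i p) := by
  have hli {p : N} (hp : p ∈ (chartAt (EuclideanSpace ℝ (Fin n)) q).source) :=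
    linearIndependent_coordField hp (tangentBasis (n := n) q).linearIndependent
  refine ⟨fun i p ↦ InnerProductSpace.gramSchmidtNormed ℝ
    (fun j ↦ coordField (tangentBasis (n := n) q j) p) i, fun i ↦ ?_, ?_⟩
  · exact ContMDiffAlongAt.gramSchmidtNormed le_rfl contMDiffAt_id
      (fun j ↦ contMDiffAlongAt_coordField _ le_rfl (mem_chart_source _ q))
      (hli (mem_chart_source _ q)) i
  · filter_upwards [eventually_mem_chart (n := n) (φ := fun p : N ↦ p) (x := q) continuousAt_id]
      with p hp
    exact InnerProductSpace.gramSchmidtNormed_orthonormal (hli hp)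

lemma finrank_tangentSpace (q : N) : Module.finrank ℝ (TangentSpace (𝓡 n) q) = n := by
  simpa using Module.finrank_eq_card_basis (tangentBasis (n := n) q)

/-- An orthonormal family indexed by `Fin n` is an orthonormal basis of the tangent space. -/
def orthonormalBasisOfFamily {q : N} {g : Fin n → TangentSpace (𝓡 n) q} (hg : Orthonormal ℝ g) :
    OrthonormalBasis (Fin n) ℝ (TangentSpace (𝓡 n) q) :=
  OrthonormalBasis.mk hg (hg.linearIndependent.span_eq_top_of_card_eq_finrank'
    (by simp [finrank_tangentSpace])).ge

lemma orthonormalBasisOfFamily_apply {q : N} {g : Fin n → TangentSpace (𝓡 n) q}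
    (hg : Orthonormal ℝ g) (i : Fin n) : orthonormalBasisOfFamily hg i = g i := by
  simp [orthonormalBasisOfFamily]

/-- A section is smooth when its inner products with coordinate fields are. -/
lemma contMDiffAlongAt_of_inner_coordField (hφ : ContMDiffAt (𝓡 m) (𝓡 n) ∞ φ x)
    (h : ∀ u : TangentSpace (𝓡 n) (φ x),
      ContMDiffAt (𝓡 m) 𝓘(ℝ, ℝ) ∞ (fun y ↦ (inner ℝ (coordField u (φ y)) (W y) : ℝ)) x) :
    ContMDiffAlongAt m ∞ φ W x := by
  obtain ⟨G, hG, hort⟩ := exists_orthonormalFrame (n := n) (φ x)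
  have hGφ (i : Fin n) : ContMDiffAlongAt m ∞ φ (fun y ↦ G i (φ y)) x := (hG i).comp hφ
  have hinner (i : Fin n) :
      ContMDiffAt (𝓡 m) 𝓘(ℝ, ℝ) ∞ (fun y ↦ (inner ℝ (G i (φ y)) (W y) : ℝ)) x := by
    obtain ⟨f, hf, hfG⟩ := (hGφ i).exists_sum
    have : (fun y ↦ (inner ℝ (G i (φ y)) (W y) : ℝ)) =ᶠ[𝓝 x]
        fun y ↦ ∑ j, f j y * inner ℝ (coordField (tangentBasis (n := n) (φ x) j) (φ y)) (W y) := by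
      filter_upwards [hfG] with y hy
      rw [hy, sum_inner]
      simp only [real_inner_smul_left]
    refine ContMDiffAt.congr_of_eventuallyEq ?_ this
    exact ContMDiffAt.sum fun j _ ↦ (hf j).mul (h _)
  refine (ContMDiffAlongAt.sum (s := Finset.univ) hφ
    fun i _ ↦ (hGφ i).smul (hinner i)).congr ?_
  filter_upwards [hφ.continuousAt.eventually hort] with y hy
  have := (orthonormalBasisOfFamily hy).sum_repr' (W y)
  simp only [orthonormalBasisOfFamily_apply] at this
  exact this.symm

end Frames

section Smoothness

variable {n : ℕ} {N : Type*} [TopologicalSpace N] [ChartedSpace (EuclideanSpace ℝ (Fin n)) N]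
  [IsManifold (𝓡 n) ∞ N]
  {m : ℕ} {M : Type*} [TopologicalSpace M] [ChartedSpace (EuclideanSpace ℝ (Fin m)) M]
  [IsManifold (𝓡 m) ∞ M] {φ : M → N} {W Z : ∀ y : M, TangentSpace (𝓡 n) (φ y)} {x : M}
  {k : WithTop ℕ∞} {X : ∀ y : M, TangentSpace (𝓡 m) y}

lemma contMDiffAlongAt_mfderiv (hk : k + 1 ≤ ∞) (hφ : ContMDiffAt (𝓡 m) (𝓡 n) ∞ φ x)
    (hX : ContMDiffAlongAt m k (fun y : M ↦ y) X x) :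
    ContMDiffAlongAt m k φ (fun y ↦ mfderiv (𝓡 m) (𝓡 n) φ y (X y)) x :=
  ContMDiffAt.clm_apply_of_inCoordinates (b₁ := fun y : M ↦ y) (b₂ := φ) (m₀ := x)
    (hφ.mfderiv_const hk) hX (hφ.of_le (le_self_add.trans hk))

lemma contMDiffAt_mvfderiv (hk : k + 1 ≤ ∞) {f : M → ℝ} (hf : ContMDiffAt (𝓡 m) 𝓘(ℝ, ℝ) ∞ f x)
    (hX : ContMDiffAlongAt m k (fun y : M ↦ y) X x) :
    ContMDiffAt (𝓡 m) 𝓘(ℝ, ℝ) k (fun y ↦ mvfderiv (𝓡 m) f y (X y)) x := by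
  have h := ContMDiffAt.clm_apply_of_inCoordinates (b₁ := fun y : M ↦ y) (b₂ := f) (m₀ := x)
    (F₁ := EuclideanSpace ℝ (Fin m)) (E₁ := fun y : M ↦ TangentSpace (𝓡 m) y)
    (F₂ := ℝ) (E₂ := fun t : ℝ ↦ TangentSpace 𝓘(ℝ, ℝ) t) (IB₂ := 𝓘(ℝ, ℝ))
    (hf.mfderiv_const hk) hX (hf.of_le (le_self_add.trans hk))
  have h2 := (contMDiffAt_totalSpace.1 h).2
  simp only [_root_.trivializationAt_model_space_apply] at h2
  exact h2

variable [RiemannianBundle (fun q : N ↦ TangentSpace (𝓡 n) q)]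
  [IsContMDiffRiemannianBundle (𝓡 n) ∞ (EuclideanSpace ℝ (Fin n))
    (fun q : N ↦ TangentSpace (𝓡 n) q)]

lemma leviCivita_coordField_comm {q p : N}
    (hp : p ∈ (chartAt (EuclideanSpace ℝ (Fin n)) q).source) (u w : TangentSpace (𝓡 n) q) :
    leviCivita (coordField w) (coordField u p) = leviCivita (coordField u) (coordField w p) := by
  have h := covDerivAlong_mfderiv_coordField_comm (φ := fun p : N ↦ p) contMDiffAt_id hp w u
  have hid (v : TangentSpace (𝓡 n) q) :
      (fun z ↦ mfderiv (𝓡 n) (𝓡 n) (fun p : N ↦ p) z (coordField v z)) = coordField v := by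
    funext z
    exact congrArg (fun L ↦ L (coordField v z)) (mfderiv_id (I := 𝓡 n) (x := z))
  rwa [hid, hid] at h

/-- Covariant derivatives of coordinate fields along coordinate fields are smooth. -/
lemma contMDiffAlongAt_leviCivita_coordField {q : N} (u w : TangentSpace (𝓡 n) q) :
    ContMDiffAlongAt n ∞ (fun p : N ↦ p)
      (fun p ↦ leviCivita (coordField w) (coordField u p)) q := by
  refine contMDiffAlongAt_of_inner_coordField contMDiffAt_id fun z ↦ ?_
  have hE (u : TangentSpace (𝓡 n) q) :=
    contMDiffAlongAt_coordField (k := ∞) u le_rfl (mem_chart_source _ q)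
  have hd (u w z : TangentSpace (𝓡 n) q) : ContMDiffAt (𝓡 n) 𝓘(ℝ, ℝ) ∞ (fun p ↦
      mvfderiv (𝓡 n) (fun p : N ↦ (inner ℝ (coordField w p) (coordField z p) : ℝ)) p
        (coordField u p)) q :=
    contMDiffAt_mvfderiv (by simp) ((hE w).inner_bundle le_rfl (hE z)) (hE u)
  refine ContMDiffAt.congr_of_eventuallyEq
    (((hd u w z).add (hd w u z)).sub (hd z u w) |>.mul (contMDiffAt_const (c := (1 / 2 : ℝ)))) ?_
  filter_upwards [eventually_mem_chart (n := n) (φ := fun p : N ↦ p) (x := q) continuousAt_id]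
    with p hp
  have hE1 (u : TangentSpace (𝓡 n) q) := contMDiffAlongAt_coordField (k := 1) u (by simp) hp
  have hm (u w z : TangentSpace (𝓡 n) q) :
      mvfderiv (𝓡 n) (fun p : N ↦ (inner ℝ (coordField w p) (coordField z p) : ℝ)) p
        (coordField u p) = inner ℝ (leviCivita (coordField w) (coordField u p)) (coordField z p)
          + inner ℝ (coordField w p) (leviCivita (coordField z) (coordField u p)) :=
    mvfderiv_inner (hE1 w) (hE1 z) _
  simp only [hm, Pi.add_apply, Pi.mul_apply]
  rw [leviCivita_coordField_comm hp w u, leviCivita_coordField_comm hp z u,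
    leviCivita_coordField_comm hp z w, real_inner_comm (coordField z p), real_inner_comm
    (coordField w p) (leviCivita _ _)]
  ring

/-- The covariant derivative of a smooth section along a smooth vector field is smooth. -/
lemma contMDiffAlongAt_covDerivAlong (hφ : ContMDiffAt (𝓡 m) (𝓡 n) ∞ φ x)
    (hW : ContMDiffAlongAt m ∞ φ W x) (hX : ContMDiffAlongAt m ∞ (fun y : M ↦ y) X x) :
    ContMDiffAlongAt m ∞ φ (fun y ↦ covDerivAlong φ W (X y)) x := by
  obtain ⟨f, hf, hfW⟩ := hW.exists_sum
  have hdX := contMDiffAlongAt_mfderiv (by simp) hφ hX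
  obtain ⟨g, hg, hgX⟩ := hdX.exists_sum
  let E : Fin n → ∀ p : N, TangentSpace (𝓡 n) p :=
    fun i ↦ coordField (tangentBasis (n := n) (φ x) i)
  have hE (i : Fin n) : ContMDiffAlongAt m ∞ φ (fun y ↦ E i (φ y)) x :=
    (contMDiffAlongAt_coordField _ le_rfl (mem_chart_source _ _)).comp hφ
  have hLC (i j : Fin n) : ContMDiffAlongAt m ∞ φ (fun y ↦ leviCivita (E i) (E j (φ y))) x :=
    (contMDiffAlongAt_leviCivita_coordField _ _).comp hφ
  have hsum : ContMDiffAlongAt m ∞ φ (fun y ↦ ∑ i, (f i y • (∑ j, g j y •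
      leviCivita (E i) (E j (φ y))) + mvfderiv (𝓡 m) (f i) y (X y) • E i (φ y))) x :=
    .sum hφ fun i _ ↦ ((ContMDiffAlongAt.sum hφ fun j _ ↦ (hLC i j).smul (hg j)).smul (hf i)).add
      ((hE i).smul (contMDiffAt_mvfderiv (by simp) (hf i) hX))
  refine hsum.congr ?_
  have h1 : ContMDiffAt (𝓡 m) (𝓡 n) 1 φ x := hφ.of_le (by simp)
  have hf1 : ∀ᶠ y in 𝓝 x, ∀ i, ContMDiffAt (𝓡 m) 𝓘(ℝ, ℝ) 1 (f i) y := by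
    rw [Filter.eventually_all]
    exact fun i ↦ (contMDiffAt_iff_contMDiffAt_nhds (by simp)).1 ((hf i).of_le (by simp))
  filter_upwards [eventually_eventually_nhds.2 hfW, hgX, eventually_mem_chart (n := n)
    hφ.continuousAt, (contMDiffAt_iff_contMDiffAt_nhds (by simp)).1 h1, hf1]
    with y hyW hyX hy hyφ hyf
  have hE1 (i : Fin n) : ContMDiffAlongAt n 1 (fun p : N ↦ p) (E i) (φ y) :=
    contMDiffAlongAt_coordField _ (by simp) hy
  rw [covDerivAlong_congr hyW, covDerivAlong_sum_smul hyφ (fun i _ ↦ hyf i)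
    (fun i _ ↦ (hE1 i).comp hyφ)]
  refine Finset.sum_congr rfl fun i _ ↦ ?_
  congr 2
  rw [covDerivAlong_comp (hE1 i) hyφ, hyX, leviCivita, covDerivAlong_vec_sum]
  refine Finset.sum_congr rfl fun j _ ↦ ?_
  rw [covDerivAlong_vec_smul]
  rfl

end Smoothness

section Trace

lemma sum_apply_orthonormalBasis {V W ι κ : Type*} [NormedAddCommGroup V] [InnerProductSpace ℝ V]
    [AddCommGroup W] [Module ℝ W] [Fintype ι] [Fintype κ] (B : V →ₗ[ℝ] V →ₗ[ℝ] W)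
    (e : OrthonormalBasis ι ℝ V) (f : OrthonormalBasis κ ℝ V) :
    ∑ i, B (e i) (e i) = ∑ j, B (f j) (f j) := by
  classical
  have h (i : ι) : B (e i) (e i)
      = ∑ j, ∑ l, ((inner ℝ (f j) (e i) : ℝ) * inner ℝ (e i) (f l)) • B (f j) (f l) := by
    conv_lhs => rw [← f.sum_repr' (e i)]
    simp only [map_sum, map_smul, LinearMap.sum_apply, LinearMap.smul_apply, Finset.smul_sum,
      smul_smul]
    rw [Finset.sum_comm]
    refine Finset.sum_congr rfl fun j _ ↦ Finset.sum_congr rfl fun l _ ↦ ?_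
    rw [real_inner_comm (f l), mul_comm]
  simp only [h]
  rw [Finset.sum_comm]
  refine Finset.sum_congr rfl fun j _ ↦ ?_
  rw [Finset.sum_comm]
  simp only [← Finset.sum_smul, e.sum_inner_mul_inner, f.inner_eq_ite]
  simp

end Trace

section SecondFundamentalForm

variable {m n : ℕ}
  {M : Type*} [TopologicalSpace M] [ChartedSpace (EuclideanSpace ℝ (Fin m)) M]
  [IsManifold (𝓡 m) ∞ M] [RiemannianBundle (fun x : M ↦ TangentSpace (𝓡 m) x)]
  [IsContMDiffRiemannianBundle (𝓡 m) ∞ (EuclideanSpace ℝ (Fin m))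
    (fun x : M ↦ TangentSpace (𝓡 m) x)]
  {N : Type*} [TopologicalSpace N] [ChartedSpace (EuclideanSpace ℝ (Fin n)) N]
  [IsManifold (𝓡 n) ∞ N] [RiemannianBundle (fun q : N ↦ TangentSpace (𝓡 n) q)]
  [IsContMDiffRiemannianBundle (𝓡 n) ∞ (EuclideanSpace ℝ (Fin n))
    (fun q : N ↦ TangentSpace (𝓡 n) q)]
  {φ : M → N} {x : M}

lemma contMDiffAlongAt_mfderiv_coordField (hφ : ContMDiffAt (𝓡 m) (𝓡 n) ∞ φ x)
    (v : TangentSpace (𝓡 m) x) :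
    ContMDiffAlongAt m ∞ φ (fun y ↦ mfderiv (𝓡 m) (𝓡 n) φ y (coordField v y)) x :=
  contMDiffAlongAt_mfderiv (by simp) hφ
    (contMDiffAlongAt_coordField v le_rfl (mem_chart_source _ x))

/-- The Gauss formula for a vector field, expanded in a basis of the tangent space. -/
lemma covDerivAlong_sub_leviCivita_eq_sum (hφ : ContMDiffAt (𝓡 m) (𝓡 n) ∞ φ x)
    {Y : ∀ y : M, TangentSpace (𝓡 m) y} (hY : ContMDiffAlongAt m 1 (fun y : M ↦ y) Y x)
    (u : TangentSpace (𝓡 m) x) :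
    covDerivAlong φ (fun y ↦ mfderiv (𝓡 m) (𝓡 n) φ y (Y y)) u
        - mfderiv (𝓡 m) (𝓡 n) φ x (leviCivita Y u)
      = ∑ i, (tangentBasis (n := m) x).repr (Y x) i
          • secondFundamentalForm φ u (tangentBasis (n := m) x i) := by
  obtain ⟨f, hf, hfY⟩ := hY.exists_sum
  let b := tangentBasis (n := m) x
  have h1 : ContMDiffAt (𝓡 m) (𝓡 n) 1 φ x := hφ.of_le (by simp)
  have hE (i : Fin m) : ContMDiffAlongAt m 1 (fun y : M ↦ y) (coordField (b i)) x :=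
    contMDiffAlongAt_coordField (b i) (by simp) (mem_chart_source _ x)
  have hdY : ∀ᶠ y in 𝓝 x, mfderiv (𝓡 m) (𝓡 n) φ y (Y y)
      = ∑ i, f i y • mfderiv (𝓡 m) (𝓡 n) φ y (coordField (b i) y) := by
    filter_upwards [hfY] with y hy
    rw [hy, map_sum]
    simp only [map_smul]
    rfl
  have hrepr (i : Fin m) : b.repr (Y x) i = f i x := by
    have := hfY.self_of_nhds
    simp only [coordField_self] at this
    rw [this]
    exact congrFun (b.repr_sum_self fun i ↦ f i x) i
  have hLC : leviCivita Y u = ∑ i, (f i x • leviCivita (coordField (b i)) u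
      + mvfderiv (𝓡 m) (f i) x u • b i) := by
    rw [leviCivita, covDerivAlong_congr hfY,
      covDerivAlong_sum_smul (φ := fun y : M ↦ y) contMDiffAt_id (fun i _ ↦ hf i) (fun i _ ↦ hE i)]
    simp only [coordField_self]
    rfl
  rw [covDerivAlong_congr hdY, covDerivAlong_sum_smul h1 (fun i _ ↦ hf i)
    (fun i _ ↦ (contMDiffAlongAt_mfderiv_coordField hφ (b i)).of_le (by simp)), hLC, map_sum,
    ← Finset.sum_sub_distrib]
  refine Finset.sum_congr rfl fun i _ ↦ ?_
  change _ = b.repr (Y x) i • secondFundamentalForm φ u (b i)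
  rw [hrepr, secondFundamentalForm, map_add, map_smul, map_smul, coordField_self, smul_sub]
  abel

lemma secondFundamentalForm_eq_sum (hφ : ContMDiffAt (𝓡 m) (𝓡 n) ∞ φ x)
    (u v : TangentSpace (𝓡 m) x) :
    secondFundamentalForm (n := n) φ u v = ∑ i, (tangentBasis (n := m) x).repr v i
      • secondFundamentalForm φ u (tangentBasis (n := m) x i) := by
  have := covDerivAlong_sub_leviCivita_eq_sum hφ
    (contMDiffAlongAt_coordField (k := 1) v (by simp) (mem_chart_source _ x)) u
  rwa [coordField_self] at this

/-- The Gauss formula for an arbitrary vector field. -/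
lemma covDerivAlong_sub_leviCivita (hφ : ContMDiffAt (𝓡 m) (𝓡 n) ∞ φ x)
    {Y : ∀ y : M, TangentSpace (𝓡 m) y} (hY : ContMDiffAlongAt m 1 (fun y : M ↦ y) Y x)
    (u : TangentSpace (𝓡 m) x) :
    covDerivAlong φ (fun y ↦ mfderiv (𝓡 m) (𝓡 n) φ y (Y y)) u
        - mfderiv (𝓡 m) (𝓡 n) φ x (leviCivita Y u) = secondFundamentalForm φ u (Y x) := by
  rw [covDerivAlong_sub_leviCivita_eq_sum hφ hY, ← secondFundamentalForm_eq_sum hφ]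

/-- The second fundamental form as a bilinear map. -/
def secondFundamentalFormBilin (hφ : ContMDiffAt (𝓡 m) (𝓡 n) ∞ φ x) :
    TangentSpace (𝓡 m) x →ₗ[ℝ] TangentSpace (𝓡 m) x →ₗ[ℝ] TangentSpace (𝓡 n) (φ x) :=
  LinearMap.mk₂ ℝ (fun u v ↦ secondFundamentalForm φ u v)
    (fun u u' v ↦ by
      simp only [secondFundamentalForm, leviCivita, covDerivAlong_vec_add, map_add]
      abel)
    (fun c u v ↦ by
      simp only [secondFundamentalForm, leviCivita, covDerivAlong_vec_smul, map_smul, smul_sub])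
    (fun u v v' ↦ by
      rw [secondFundamentalForm_eq_sum hφ u (v + v'), secondFundamentalForm_eq_sum hφ u v,
        secondFundamentalForm_eq_sum hφ u v', ← Finset.sum_add_distrib]
      simp only [map_add, Finsupp.add_apply, add_smul])
    (fun c u v ↦ by
      rw [secondFundamentalForm_eq_sum hφ u (c • v), secondFundamentalForm_eq_sum hφ u v,
        Finset.smul_sum]
      simp only [map_smul, Finsupp.smul_apply, smul_assoc])

lemma secondFundamentalForm_comm (hφ : ContMDiffAt (𝓡 m) (𝓡 n) ∞ φ x)
    (u v : TangentSpace (𝓡 m) x) :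
    secondFundamentalForm (n := n) φ u v = secondFundamentalForm φ v u := by
  have h := covDerivAlong_mfderiv_coordField_comm (hφ.of_le ENat.LEInfty.out)
    (mem_chart_source _ x) u v
  simp only [coordField_self] at h
  rw [secondFundamentalForm, secondFundamentalForm, leviCivita_coordField, leviCivita_coordField,
    christoffel_comm, h]

/-- The second fundamental form of an isometric immersion takes values in the normal bundle. -/
lemma inner_secondFundamentalForm_mfderiv (hφ : IsIsometricImmersion m n φ)
    (u v z : TangentSpace (𝓡 m) x) :
    inner ℝ (secondFundamentalForm φ u v) (mfderiv (𝓡 m) (𝓡 n) φ x z) = (0 : ℝ) := by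
  have hφx : ContMDiffAt (𝓡 m) (𝓡 n) ∞ φ x := hφ.contMDiff x
  have hanti (u v z : TangentSpace (𝓡 m) x) :
      inner ℝ (secondFundamentalForm φ u v) (mfderiv (𝓡 m) (𝓡 n) φ x z)
        = -(inner ℝ (secondFundamentalForm φ u z) (mfderiv (𝓡 m) (𝓡 n) φ x v) : ℝ) := by
    have hE (v : TangentSpace (𝓡 m) x) :
        ContMDiffAlongAt m 1 (fun y : M ↦ y) (coordField v) x :=
      contMDiffAlongAt_coordField v (by simp) (mem_chart_source _ x)
    have hd (v : TangentSpace (𝓡 m) x) :=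
      (contMDiffAlongAt_mfderiv_coordField hφx v).of_le (l := 1) (by simp)
    have h1 := mvfderiv_inner (hE v) (hE z) u
    have h2 := mvfderiv_inner (hd v) (hd z) u
    simp only [hφ.inner_mfderiv, coordField_self] at h1 h2
    rw [h1, ← hφ.inner_mfderiv, ← hφ.inner_mfderiv x v] at h2
    simp only [secondFundamentalForm, inner_sub_left, leviCivita]
    rw [real_inner_comm _ (covDerivAlong φ (fun y ↦ mfderiv (𝓡 m) (𝓡 n) φ y (coordField z y)) u),
      real_inner_comm (mfderiv (𝓡 m) (𝓡 n) φ x v) (mfderiv (𝓡 m) (𝓡 n) φ x _)]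
    linarith
  have hs := secondFundamentalForm_comm hφx
  have h1 := hanti u v z
  have h2 := hanti z u v
  have h3 := hanti v z u
  rw [hs u z] at h1
  rw [hs z v] at h2
  rw [hs v u] at h3
  linarith

/-- The mean curvature in terms of a smooth orthonormal frame. -/
lemma meanCurvature_eq_sum {y : M} {G : Fin m → ∀ y : M, TangentSpace (𝓡 m) y}
    (hφ : ContMDiffAt (𝓡 m) (𝓡 n) ∞ φ y)
    (hG : ∀ i, ContMDiffAlongAt m 1 (fun y : M ↦ y) (G i) y)
    (hort : Orthonormal ℝ (fun i ↦ G i y)) :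
    meanCurvature m n φ y = (1 / (m : ℝ)) • ∑ i,
      (covDerivAlong φ (fun y ↦ mfderiv (𝓡 m) (𝓡 n) φ y (G i y)) (G i y)
        - mfderiv (𝓡 m) (𝓡 n) φ y (leviCivita (G i) (G i y))) := by
  have := sum_apply_orthonormalBasis (secondFundamentalFormBilin hφ)
    (stdOrthonormalBasis ℝ (TangentSpace (𝓡 m) y)) (orthonormalBasisOfFamily hort)
  simp only [orthonormalBasisOfFamily_apply] at this
  simp only [covDerivAlong_sub_leviCivita hφ (hG _)]
  exact congrArg ((1 / (m : ℝ)) • ·) this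

/-- The mean curvature vector field is smooth. -/
lemma contMDiffAlongAt_meanCurvature (hφ : ContMDiff (𝓡 m) (𝓡 n) ∞ φ) (x : M) :
    ContMDiffAlongAt m ∞ φ (meanCurvature m n φ) x := by
  obtain ⟨G, hG, hort⟩ := exists_orthonormalFrame (n := m) x
  have hsum : ContMDiffAlongAt m ∞ φ (fun y ↦ (1 / (m : ℝ)) • ∑ i,
      (covDerivAlong φ (fun y ↦ mfderiv (𝓡 m) (𝓡 n) φ y (G i y)) (G i y)
        - mfderiv (𝓡 m) (𝓡 n) φ y (leviCivita (G i) (G i y)))) x := by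
    refine ContMDiffAlongAt.const_smul _ (.sum (hφ x) fun i _ ↦ .sub ?_ ?_)
    · exact contMDiffAlongAt_covDerivAlong (hφ x) (contMDiffAlongAt_mfderiv (by simp) (hφ x) (hG i))
        (hG i)
    · exact contMDiffAlongAt_mfderiv (by simp) (hφ x)
        (contMDiffAlongAt_covDerivAlong contMDiffAt_id (hG i) (hG i))
  refine hsum.congr ?_
  have hG1 : ∀ᶠ y in 𝓝 x, ∀ i, ContMDiffAlongAt m 1 (fun y : M ↦ y) (G i) y := by
    rw [Filter.eventually_all]
    exact fun i ↦ (hG i).eventually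
  filter_upwards [hG1, hort] with y hy hyo
  exact meanCurvature_eq_sum (hφ y) hy hyo

lemma inner_meanCurvature_mfderiv (hφ : IsIsometricImmersion m n φ) (z : TangentSpace (𝓡 m) x) :
    inner ℝ (meanCurvature m n φ x) (mfderiv (𝓡 m) (𝓡 n) φ x z) = (0 : ℝ) := by
  rw [meanCurvature, real_inner_smul_left, sum_inner,
    Finset.sum_eq_zero fun i _ ↦ inner_secondFundamentalForm_mfderiv hφ _ _ _, mul_zero]

end SecondFundamentalForm

section MaximumPrinciple

variable {m n : ℕ}
  {M : Type*} [TopologicalSpace M] [ChartedSpace (EuclideanSpace ℝ (Fin m)) M]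
  [IsManifold (𝓡 m) ∞ M] [RiemannianBundle (fun x : M ↦ TangentSpace (𝓡 m) x)]
  [IsContMDiffRiemannianBundle (𝓡 m) ∞ (EuclideanSpace ℝ (Fin m))
    (fun x : M ↦ TangentSpace (𝓡 m) x)]
  {N : Type*} [TopologicalSpace N] [ChartedSpace (EuclideanSpace ℝ (Fin n)) N]
  [IsManifold (𝓡 n) ∞ N] [RiemannianBundle (fun q : N ↦ TangentSpace (𝓡 n) q)]
  [IsContMDiffRiemannianBundle (𝓡 n) ∞ (EuclideanSpace ℝ (Fin n))
    (fun q : N ↦ TangentSpace (𝓡 n) q)]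
  {φ : M → N} {W : ∀ y : M, TangentSpace (𝓡 n) (φ y)} {x : M}

/-- At a local maximum of `|W|^2`, `⟨∇^2_{v,v} W, W⟩ + |∇_v W|^2 ≤ 0`. -/
lemma inner_secondCovDerivAlong_add_norm_sq_nonpos (hφ : ContMDiff (𝓡 m) (𝓡 n) ∞ φ)
    (hW : ∀ y, ContMDiffAlongAt m ∞ φ W y)
    (hmax : IsLocalMax (fun y ↦ (inner ℝ (W y) (W y) : ℝ)) x) (v : TangentSpace (𝓡 m) x) :
    inner ℝ (secondCovDerivAlong φ W v v) (W x) + ‖covDerivAlong φ W v‖ ^ 2 ≤ 0 := by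
  set f : M → ℝ := fun y ↦ inner ℝ (W y) (W y) with hf
  have hfs : ContMDiffAt (𝓡 m) 𝓘(ℝ, ℝ) 2 f x :=
    ((hW x).inner_bundle le_rfl (hW x)).of_le ENat.LEInfty.out
  have hW1 (y : M) : ContMDiffAlongAt m 1 φ W y := (hW y).of_le (by simp)
  have hd (y : M) (u : TangentSpace (𝓡 m) y) :
      mvfderiv (𝓡 m) f y u = 2 * inner ℝ (covDerivAlong φ W u) (W y) := by
    rw [hf, mvfderiv_inner (hW1 y) (hW1 y), real_inner_comm (covDerivAlong φ W u)]
    ring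
  have hD : ContMDiffAlongAt m 1 φ (fun y ↦ covDerivAlong φ W (coordField v y)) x :=
    (contMDiffAlongAt_covDerivAlong (hφ x) (hW x)
      (contMDiffAlongAt_coordField v le_rfl (mem_chart_source _ x))).of_le (by simp)
  have h1 := mvfderiv_eq_zero_of_isLocalMax hmax hfs (leviCivita (coordField v) v)
  have h2 := mvfderiv_mvfderiv_nonpos_of_isLocalMax hmax hfs v
  simp only [hd] at h1 h2
  rw [mvfderiv_fun_mul mdifferentiableAt_const
    ((hD.inner_bundle (by simp) (hW1 x)).mdifferentiableAt (by simp)), mvfderiv_const, add_apply,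
    smul_apply, mvfderiv_inner hD (hW1 x), coordField_self, real_inner_self_eq_norm_sq] at h2
  simp only [smul_zero, zero_apply, add_zero, smul_eq_mul] at h2
  rw [secondCovDerivAlong, inner_sub_left]
  linarith

/-- The curvature term of a non-positively curved manifold on an orthogonal pair. -/
lemma inner_curvature_nonpos (hN : NonposSectionalCurvature n N) {q : N}
    {u v : TangentSpace (𝓡 n) q} (hu : u ≠ 0) (hv : v ≠ 0) (huv : (inner ℝ u v : ℝ) = 0) :
    (inner ℝ (curvature u v v) u : ℝ) ≤ 0 := by
  have hli : LinearIndependent ℝ ![u, v] := by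
    refine linearIndependent_of_ne_zero_of_inner_eq_zero (𝕜 := ℝ) (fun i ↦ ?_) fun i j hij ↦ ?_
    · fin_cases i <;> simpa
    · fin_cases i <;> fin_cases j <;> simp_all [real_inner_comm]
  have h := hN q u v hli
  rw [sectionalCurvature, huv] at h
  have hpos : 0 < ‖u‖ ^ 2 * ‖v‖ ^ 2 - (0 : ℝ) ^ 2 := by
    have h1 := norm_pos_iff.2 hu
    have h2 := norm_pos_iff.2 hv
    rw [zero_pow two_ne_zero, sub_zero]
    positivity
  by_contra! hc
  exact absurd h (not_le.2 (div_pos hc hpos))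

lemma inner_normalPart_meanCurvature (hφ : IsIsometricImmersion m n φ)
    (w : TangentSpace (𝓡 n) (φ x)) :
    (inner ℝ (normalPart m n φ x w) (meanCurvature m n φ x) : ℝ)
      = inner ℝ w (meanCurvature m n φ x) := by
  have hmem : meanCurvature m n φ x
      ∈ (LinearMap.range (mfderiv (𝓡 m) (𝓡 n) φ x).toLinearMap)ᗮ := by
    rw [Submodule.mem_orthogonal]
    rintro _ ⟨z, rfl⟩
    rw [real_inner_comm]
    exact inner_meanCurvature_mfderiv hφ z
  rw [normalPart, Submodule.inner_starProjection_left_eq_right,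
    Submodule.starProjection_eq_self_iff.2 hmem]

/-- A biminimal submanifold has `⟨Δ H, H⟩ ≥ 0` when the target is non-positively curved. -/
lemma inner_laplacianAlong_meanCurvature_nonneg (hN : NonposSectionalCurvature n N) {l : ℝ}
    (hl : 0 ≤ l) (hφ : IsBiminimalSubmanifold m n φ l) (hH : meanCurvature m n φ x ≠ 0) :
    0 ≤ (inner ℝ (laplacianAlong m n φ (meanCurvature m n φ) x) (meanCurvature m n φ x) : ℝ) := by
  have h := congrArg (fun w ↦ (inner ℝ w (meanCurvature m n φ x) : ℝ)) (hφ.biminimal_eq x)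
  simp only [inner_add_left, inner_normalPart_meanCurvature hφ.isIsometricImmersion,
    inner_sub_left, inner_neg_left, sum_inner, real_inner_smul_left, inner_zero_left] at h
  have hR : ∑ i, (inner ℝ (curvature (meanCurvature m n φ x)
      (mfderiv (𝓡 m) (𝓡 n) φ x (stdOrthonormalBasis ℝ (TangentSpace (𝓡 m) x) i))
      (mfderiv (𝓡 m) (𝓡 n) φ x (stdOrthonormalBasis ℝ (TangentSpace (𝓡 m) x) i)))
      (meanCurvature m n φ x) : ℝ) ≤ 0 := by
    refine Finset.sum_nonpos fun i _ ↦ inner_curvature_nonpos hN hH (fun h0 ↦ ?_)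
      (inner_meanCurvature_mfderiv hφ.isIsometricImmersion _)
    have h1 := hφ.isIsometricImmersion.inner_mfderiv x
      (stdOrthonormalBasis ℝ (TangentSpace (𝓡 m) x) i)
      (stdOrthonormalBasis ℝ (TangentSpace (𝓡 m) x) i)
    rw [h0, inner_zero_left, OrthonormalBasis.inner_eq_one] at h1
    exact zero_ne_one h1
  have hl' : 0 ≤ l * (inner ℝ (meanCurvature m n φ x) (meanCurvature m n φ x) : ℝ) :=
    mul_nonneg hl real_inner_self_nonneg
  linarith

/-- If the mean curvature vector field is parallel at `x` then it vanishes at `x`. -/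
lemma meanCurvature_eq_zero_of_covDerivAlong_eq_zero (hφ : IsIsometricImmersion m n φ)
    (h : ∀ i, covDerivAlong φ (meanCurvature m n φ)
      (stdOrthonormalBasis ℝ (TangentSpace (𝓡 m) x) i) = 0) : meanCurvature m n φ x = 0 := by
  have hφx : ContMDiffAt (𝓡 m) (𝓡 n) ∞ φ x := hφ.contMDiff x
  let e := stdOrthonormalBasis ℝ (TangentSpace (𝓡 m) x)
  have hB (i) : (inner ℝ (secondFundamentalForm φ (e i) (e i)) (meanCurvature m n φ x) : ℝ) = 0 := by
    have h1 := mvfderiv_inner ((contMDiffAlongAt_meanCurvature hφ.contMDiff x).of_le (by simp))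
      ((contMDiffAlongAt_mfderiv_coordField hφx (e i)).of_le (by simp)) (e i)
    simp only [inner_meanCurvature_mfderiv hφ] at h1
    rw [mvfderiv_const, h i, inner_zero_left, zero_add, zero_apply] at h1
    rw [secondFundamentalForm, inner_sub_left, real_inner_comm, ← h1, real_inner_comm,
      inner_meanCurvature_mfderiv hφ, sub_zero]
  have h0 : (inner ℝ (meanCurvature m n φ x) (meanCurvature m n φ x) : ℝ) = 0 := by
    conv_lhs => arg 2; rw [meanCurvature]
    rw [real_inner_smul_left, sum_inner, Finset.sum_eq_zero fun i _ ↦ hB i, mul_zero]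
  exact inner_self_eq_zero.1 h0

end MaximumPrinciple

end Biminimal

end

theorem proposition3p5 {m n : ℕ}
    {M : Type*} [TopologicalSpace M] [T2Space M] [CompactSpace M]
    [ChartedSpace (EuclideanSpace ℝ (Fin m)) M] [IsManifold (𝓡 m) ∞ M]
    [RiemannianBundle (fun x : M ↦ TangentSpace (𝓡 m) x)]
    [IsContMDiffRiemannianBundle (𝓡 m) ∞ (EuclideanSpace ℝ (Fin m))
      (fun x : M ↦ TangentSpace (𝓡 m) x)]
    {N : Type*} [TopologicalSpace N] [T2Space N]
    [ChartedSpace (EuclideanSpace ℝ (Fin n)) N] [IsManifold (𝓡 n) ∞ N]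
    [RiemannianBundle (fun q : N ↦ TangentSpace (𝓡 n) q)]
    [IsContMDiffRiemannianBundle (𝓡 n) ∞ (EuclideanSpace ℝ (Fin n))
      (fun q : N ↦ TangentSpace (𝓡 n) q)]
    (hN : Biminimal.NonposSectionalCurvature n N)
    (φ : M → N) (hφ : Biminimal.IsNonnegBiminimalSubmanifold m n φ) :
    Biminimal.IsMinimal m n φ := by
  obtain ⟨l, hl, hb⟩ := hφ
  have hiso := hb.isIsometricImmersion
  have hH (y : M) := Biminimal.contMDiffAlongAt_meanCurvature hiso.contMDiff y
  intro x
  have hcont : Continuous fun y : M ↦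
      (inner ℝ (Biminimal.meanCurvature m n φ y) (Biminimal.meanCurvature m n φ y) : ℝ) :=
    continuous_iff_continuousAt.2 fun y ↦ ((hH y).inner_bundle le_rfl (hH y)).continuousAt
  obtain ⟨x₀, -, hx₀⟩ := isCompact_univ.exists_isMaxOn ⟨x, Set.mem_univ x⟩ hcont.continuousOn
  suffices h0 : Biminimal.meanCurvature m n φ x₀ = 0 by
    have h := hx₀ (Set.mem_univ x)
    simp only [Set.mem_ofPred_eq, h0, inner_zero_left] at h
    exact inner_self_eq_zero.1 (le_antisymm h real_inner_self_nonneg)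
  by_contra hne
  have hmax := hx₀.isLocalMax Filter.univ_mem
  have hle := Finset.sum_nonpos fun i (_ : i ∈ Finset.univ) ↦
    Biminimal.inner_secondCovDerivAlong_add_norm_sq_nonpos hiso.contMDiff hH hmax
      (stdOrthonormalBasis ℝ (TangentSpace (𝓡 m) x₀) i)
  have hlap := Biminimal.inner_laplacianAlong_meanCurvature_nonneg hN hl hb hne
  rw [Biminimal.laplacianAlong, sum_inner] at hlap
  rw [Finset.sum_add_distrib] at hle
  have hsum : ∑ i, ‖Biminimal.covDerivAlong φ (Biminimal.meanCurvature m n φ)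
      (stdOrthonormalBasis ℝ (TangentSpace (𝓡 m) x₀) i)‖ ^ 2 = 0 :=
    le_antisymm (by linarith) (Finset.sum_nonneg fun i _ ↦ sq_nonneg _)
  refine hne (Biminimal.meanCurvature_eq_zero_of_covDerivAlong_eq_zero hiso fun i ↦ ?_)
  have := (Finset.sum_eq_zero_iff_of_nonneg fun i _ ↦ sq_nonneg _).1 hsum i (Finset.mem_univ i)
  exact norm_eq_zero.1 (pow_eq_zero_iff two_ne_zero |>.1 this)
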